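/- Let $n\ge 2$ and $E=\mathbb{R}^{2n-2}\times S^1$ with $S^1=\mathbb{R}/2\pi\mathbb{Z}$. Let $\mathfrak{c}_k$ denote the metric of complex hyperbolic space $\mathbb{CH}^k$ of constant holomorphic sectional curvature $-4$. Identify $\mathbb{R}^{2n-2}=\mathbb{C}^{n-1}$ with $\mathbb{CH}^{n-1}$ (the unit ball of $\mathbb{C}^{n-1}$) by the diffeomorphism $z\mapsto z/\sqrt{1+|z|^2}$, and identify $E\times(0,\infty)$ with $\mathbb{CH}^n\setminus\mathbb{CH}^{n-1}$ by polar coordinates about $\mathbb{CH}^{n-1}=\{w=0\}$ in the unit ball $\mathbb{CH}^n=\{(p,w)\in\mathbb{C}^{n-1}\times\mathbb{C} : |p|^2+|w|^2<1\}$: the point $(z,\theta,r)$ corresponds to $(p,w)$ with $p=z/\sqrt{1+|z|^2}$ and $w=\sqrt{1-|p|^2}\,\tanh(r)\,e^{i\theta}$, so that $p$ is the orthogonal projection to $\mathbb{CH}^{n-1}$ and $r$ is the distance to $\mathbb{CH}^{n-1}$. Through these identifications regard $\mathfrak{c}_{n-1}$ as a metric on $\mathbb{R}^{2n-2}$ and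 $\mathfrak{c}_n$ as a metric on $E\times(0,\infty)$, and let $$g_I=\cosh^2(r)\,\mathfrak{c}_{n-1}+\tfrac14\sinh^2(2r)\,d\theta^2+dr^2$$ on $E\times(0,\infty)$, where $d\theta$ is the coordinate form of the product $\mathbb{R}^{2n-2}\times S^1\times(0,\infty)$ (the integrable complex hyperbolic metric). Then for every $\varepsilon>0$ there exist constants $0<r_3<r_4$ and a smooth Riemannian metric $g$ on $E\times[r_3,\infty)$ such that 1. $g=g_I$ at every point of $E\times\{r_3\}$; 2. $g=\mathfrak{c}_n$ on $E\times(r_4,\infty)$; 3. all sectional curvatures of $g$ lie in the interval $(-4-\varepsilon,-1+\varepsilon)$. -/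

import Mathlib

open Set
open scoped ContDiff

noncomputable section

namespace Warping

/-! ## Sectional curvature in coordinates

`V` is a finite-dimensional real vector space used as a coordinate space and `S ⊆ V` is a domain
with or without boundary (an open set, a closed half-space, ...). A metric is a field
`g : V → V →L[ℝ] V →L[ℝ] ℝ` of bilinear forms on `S`. All derivatives are taken within `S`, so
that they are one-sided at boundary points and the usual ones at interior points. -/

section Curvature

variable {V : Type*} [NormedAddCommGroup V] [NormedSpace ℝ V]

/-- The functional `w ↦ ½ ((∂_u g)(v, w) + (∂_v g)(u, w) - (∂_w g)(u, v))` at `x`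
(the Christoffel symbols of the first kind). -/
def christoffelLower (S : Set V) (g : V → V →L[ℝ] V →L[ℝ] ℝ) (x u v : V) : V →L[ℝ] ℝ :=
  (1 / 2 : ℝ) • (fderivWithin ℝ g S x u v + fderivWithin ℝ g S x v u
    - ((fderivWithin ℝ g S x).flip u).flip v)

/-- `Γ_x(u, v) = ∇_u v` for constant vector fields `u`, `v`, where `∇` is the Levi-Civita connection
of `g`: the vector that `g x` pairs with `w` to `christoffelLower S g x u v w`. (If `g x` is
nondegenerate on a finite-dimensional `V`, then `g x`, as a map from `V` to its dual, is
invertible, and `inverse` is its inverse.) -/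
def christoffel (S : Set V) (g : V → V →L[ℝ] V →L[ℝ] ℝ) (x u v : V) : V :=
  (g x).inverse (christoffelLower S g x u v)

/-- The Riemann curvature tensor `R(u, v) w = ∇_u ∇_v w - ∇_v ∇_u w` at `x`
for constant vector fields `u`, `v`, `w`. -/
def riemannCurvature (S : Set V) (g : V → V →L[ℝ] V →L[ℝ] ℝ) (x u v w : V) : V :=
  fderivWithin ℝ (fun y => christoffel S g y v w) S x u
    - fderivWithin ℝ (fun y => christoffel S g y u w) S x v
    + christoffel S g x u (christoffel S g x v w)
    - christoffel S g x v (christoffel S g x u w)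

/-- The sectional curvature of the plane spanned by the linearly independent vectors `u`, `v`,
`K = g(R(u, v) v, u) / (g(u, u) g(v, v) - g(u, v)²)`. -/
def sectionalCurvature (S : Set V) (g : V → V →L[ℝ] V →L[ℝ] ℝ) (x u v : V) : ℝ :=
  g x (riemannCurvature S g x u v v) u / (g x u u * g x v v - g x u v ^ 2)

end Curvature

/-! ## The complex hyperbolic metric -/

/-- The metric of complex hyperbolic space of constant holomorphic sectional curvature `-4` in the
unit ball model: for a complex inner product space `H` and `‖p‖ < 1`, it is the real part of
`⟪u, v⟫ / (1 - ‖p‖²) + ⟪u, p⟫ ⟪p, v⟫ / (1 - ‖p‖²)²`.  -/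
def ballMetric {H : Type*} [NormedAddCommGroup H] [InnerProductSpace ℂ H] (p u v : H) : ℝ :=
  (inner ℂ u v / (1 - (‖p‖ : ℂ) ^ 2)
    + inner ℂ u p * inner ℂ p v / (1 - (‖p‖ : ℂ) ^ 2) ^ 2).re

/-! ## The space `E × ℝ` and its coordinates

`n` is the complex dimension. `ℝ^(2n-2)` is `ℂ^(n-1)`, and `S¹` is `ℝ / 2πℤ`. -/

/-- `ℝ^(2n-2)`, written as the real vector space `ℂ^(n-1)`. -/
abbrev Base (n : ℕ) : Type := EuclideanSpace ℂ (Fin (n - 1))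

/-- `E = ℝ^(2n-2) × S¹`. -/
abbrev E (n : ℕ) : Type := Base n × AddCircle (2 * Real.pi)

/-- The space of triples `(z, θ, r)`. It is the universal cover of `E × ℝ`, and, since the
covering map is given by translations, also the tangent space of `E × ℝ` at each point: `(ζ, a, b)`
is the tangent vector `ζ + a ∂/∂θ + b ∂/∂r`. -/
abbrev Cover (n : ℕ) : Type := Base n × ℝ × ℝ

/-- The covering map `(z, θ, r) ↦ (z, θ mod 2π, r)`, a local isometry for the pulled-back metric. -/
def toE {n : ℕ} (x : Cover n) : E n × ℝ := ((x.1, (x.2.1 : AddCircle (2 * Real.pi))), x.2.2)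

/-- The part `r ≥ a` of the cover, that is, the universal cover of `E × [a, ∞)`. -/
def halfSpace (n : ℕ) (a : ℝ) : Set (Cover n) := {x | a ≤ x.2.2}

/-- A field of bilinear forms on the tangent spaces of `E × ℝ`. -/
abbrev FormField (n : ℕ) : Type := E n × ℝ → Cover n →L[ℝ] Cover n →L[ℝ] ℝ

/-- The field of bilinear forms, pulled back to the cover. -/
def FormField.lift {n : ℕ} (g : FormField n) : Cover n → Cover n →L[ℝ] Cover n →L[ℝ] ℝ :=
  fun x => g (toE x)

/-- `g` is a smooth Riemannian metric on the manifold with boundary `E × [a, ∞)` (smooth up to the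
boundary). Its values where `r < a` are irrelevant. -/
structure IsRiemannianMetric {n : ℕ} (a : ℝ) (g : FormField n) : Prop where
  symm : ∀ q : E n × ℝ, a ≤ q.2 → ∀ u v, g q u v = g q v u
  pos : ∀ q : E n × ℝ, a ≤ q.2 → ∀ u, u ≠ 0 → 0 < g q u u
  smooth : ContDiffOn ℝ ∞ g.lift (halfSpace n a)

/-! ## The metrics `𝔠_{n-1}`, `𝔠_n` and `g_I` in polar coordinates -/

/-- The diffeomorphism `z ↦ z / √(1 + ‖z‖²)` from `ℝ^(2n-2) = ℂ^(n-1)` to the unit ball of `ℂ^(n-1)`,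
which identifies `ℝ^(2n-2)` with `ℂℍ^(n-1)`. -/
def toBall {n : ℕ} (z : Base n) : Base n := (√(1 + ‖z‖ ^ 2))⁻¹ • z

/-- The metric `𝔠_{n-1}` of `ℂℍ^(n-1)`, on `ℝ^(2n-2)`. -/
def coreMetric {n : ℕ} (z u v : Base n) : ℝ :=
  ballMetric (toBall z) (fderiv ℝ toBall z u) (fderiv ℝ toBall z v)

/-- Polar coordinates of `ℂℍ^n` (the unit ball of `ℂ^n = ℂ^(n-1) ⊕ ℂ`) about the complex hyperplane
`ℂℍ^(n-1)` (the points of the ball whose last coordinate is `0`). The orthogonal projection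
`ℂℍ^n → ℂℍ^(n-1)` is `(p, w) ↦ p`, the distance `r` of `(p, w)` from `ℂℍ^(n-1)` is given by
`tanh r = |w| / √(1 - ‖p‖²)`, and `θ` is the argument of `w`. -/
def polar {n : ℕ} (x : Cover n) : WithLp 2 (Base n × ℂ) :=
  WithLp.toLp 2 (toBall x.1,
    ((√(1 - ‖toBall x.1‖ ^ 2) * Real.tanh x.2.2 : ℝ) : ℂ) * Complex.exp (x.2.1 * Complex.I))

/-- The complex hyperbolic metric `𝔠_n` on `E × (0, ∞)`, in the coordinates `(z, θ, r)`. It does not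
change if `2π` is added to `θ`. -/
def complexHyperbolicMetric {n : ℕ} (x u v : Cover n) : ℝ :=
  ballMetric (polar x) (fderiv ℝ polar x u) (fderiv ℝ polar x v)

/-- The integrable complex hyperbolic metric
`g_I = cosh²(r) 𝔠_{n-1} + ¼ sinh²(2r) dθ² + dr²` in the coordinates `(z, θ, r)`: the horizontal
distribution is `ker dθ ∩ ker dr`, so that all structure constants vanish. -/
def integrableMetric {n : ℕ} (x u v : Cover n) : ℝ :=
  Real.cosh x.2.2 ^ 2 * coreMetric x.1 u.1 v.1
    + 1 / 4 * Real.sinh (2 * x.2.2) ^ 2 * (u.2.1 * v.2.1) + u.2.2 * v.2.2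

end Warping

end

open Set
open scoped ContDiff

noncomputable section

set_option maxSynthPendingDepth 3
set_option linter.unusedSimpArgs false
set_option linter.unusedSectionVars false

/-! Let `β = Im⟪z, ·⟫` on `ℂ^(n-1)`. In the coordinate `z` the Kähler form of `𝔠_{n-1}` has constant
coefficients and `dβ` is twice it. With `B = sinh r cosh r`, both model metrics have the form `cosh²
r 𝔠_{n-1} + B² (dθ + φ β)² + dr²`: `φ = 1` gives `𝔠_n` (`complexHyperbolicMetric_eq`) and `φ = 0`
gives `g_I` (`integrableMetric_eq`). So `φ` has to be switched on without spoiling the curvature.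

The curvature (`warpForm_curvature`) is governed by `σ = Bφ/cosh²`, `μ = Bφ'/cosh`, `ν = Bφ''/cosh`,
`l = B'/B`, `k = B''/B`, with `L = tanh r` near `1` and `i = 1/cosh r` near `0` for large `r`. The
terms with `μ` or `ν` are errors, because `β` and its covariant derivative are bounded on the whole
base (`curvature_error_le`). The rest lies between `-4` and `-1`, up to small errors, if either `σ`
is small or `l` is near `2` (`curvature_main_bounds`).

With `B = sinh r cosh r`, a small `μ` would force `φ'` to decay like `e^(-r)`, and at large `r` its
integral cannot reach `1`. Hence `B` is damped to `sinh r cosh r e^(-ψ)` (`exists_warping_profile`).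
While `ψ' = 1`, `B` grows only like `e^r`, `μ` is a bounded multiple of `φ'`, and a very slow
cut-off takes `φ` to `1`, at a time when `σ ≤ e^(-ψ)` is tiny. Then the slope of `ψ` drops, still
with `σ` tiny, to `-δ`, and `ψ` drifts back to `0`: `σ` climbs towards `1` while `l` stays near `2`.

At `r₃` only the values of the metrics agree: `φ = ψ = 0` there, but `ψ' = 1`. -/

namespace Warping

/-! ### Curvature from directional derivatives of the metric -/

section GeneralCurvature

variable {V : Type*} [NormedAddCommGroup V] [NormedSpace ℝ V]

/-- A positive definite bilinear form on a finite-dimensional space is invertible, as a map to the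
dual. -/
theorem isInvertible_of_posDef [FiniteDimensional ℝ V] {B : V →L[ℝ] V →L[ℝ] ℝ}
    (hB : ∀ u, u ≠ 0 → 0 < B u u) : B.IsInvertible := by
  have hinj : Function.Injective (B : V →ₗ[ℝ] V →L[ℝ] ℝ) := by
    rw [injective_iff_map_eq_zero]
    intro u hu
    by_contra h
    have h1 := hB u h
    have h2 : B u = 0 := hu
    rw [h2] at h1
    simp at h1
  have hdim : Module.finrank ℝ V = Module.finrank ℝ (V →L[ℝ] ℝ) := by
    rw [← (LinearMap.toContinuousLinearMap (𝕜 := ℝ) (E := V) (F' := ℝ)).finrank_eq]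
    exact (Subspace.dual_finrank_eq (K := ℝ) (V := V)).symm
  let e := (LinearEquiv.ofInjectiveOfFinrankEq (B : V →ₗ[ℝ] V →L[ℝ] ℝ) hinj
    hdim).toContinuousLinearEquiv
  exact ⟨e, by ext u; rfl⟩

/-- The Christoffel symbols of the first kind, with derivatives taken in the whole space. -/
def lowerSymbol (g : V → V →L[ℝ] V →L[ℝ] ℝ) (u v x : V) : V →L[ℝ] ℝ :=
  (1 / 2 : ℝ) • (fderiv ℝ g x u v + fderiv ℝ g x v u - ((fderiv ℝ g x).flip u).flip v)

theorem christoffelLower_eq {S : Set V} (hS : UniqueDiffOn ℝ S) {g : V → V →L[ℝ] V →L[ℝ] ℝ}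
    (hg : ContDiff ℝ ∞ g) {x : V} (hx : x ∈ S) (u v : V) :
    christoffelLower S g x u v = lowerSymbol g u v x := by
  have h : fderivWithin ℝ g S x = fderiv ℝ g x :=
    ((hg.differentiable (by simp)) x).fderivWithin (hS x hx)
  simp [christoffelLower, lowerSymbol, h]

theorem differentiable_lowerSymbol [FiniteDimensional ℝ V] {g : V → V →L[ℝ] V →L[ℝ] ℝ}
    (hg : ContDiff ℝ ∞ g) (u v : V) : Differentiable ℝ (lowerSymbol g u v) := by
  have h : ContDiff ℝ ∞ (fderiv ℝ g) := hg.fderiv_right (m := ∞) (by simp)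
  have h1 : ∀ a b c, ContDiff ℝ ∞ fun x => fderiv ℝ g x a b c := fun a b c =>
    ((h.clm_apply contDiff_const).clm_apply contDiff_const).clm_apply contDiff_const
  have h2 : ContDiff ℝ ∞ (lowerSymbol g u v) := by
    rw [contDiff_clm_apply_iff]
    intro t
    simp only [lowerSymbol, smul_apply, add_apply, sub_apply, ContinuousLinearMap.flip_apply]
    exact (((h1 u v t).add (h1 v u t)).sub (h1 t u v)).const_smul _
  exact h2.differentiable (by simp)

/-- Differentiating `g(Γ(v, w), t) = lowerSymbol` gives the pairing of `∂Γ` with every `t`, so the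
inverse metric never has to be differentiated explicitly. What remains are derivatives of `g` along
lines and the vectors `a`, `b`, `c`, identified with `Γ(u, u)`, `Γ(u, v)`, `Γ(v, v)` by
nondegeneracy. Smoothness of `g` on all of `V` makes the one-sided derivatives at the boundary
ordinary ones. -/
theorem metric_riemannCurvature [FiniteDimensional ℝ V] {S : Set V} (hS : UniqueDiffOn ℝ S)
    {g : V → V →L[ℝ] V →L[ℝ] ℝ} (hg : ContDiff ℝ ∞ g) (hsymm : ∀ y v w, g y v w = g y w v)
    {x : V} (hx : x ∈ S) (hpos : ∀ u, u ≠ 0 → 0 < g x u u)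
    {G1 : V → V → V → V → ℝ} {G2 : V → V → V → V → ℝ}
    (hG1 : ∀ y d v w, HasDerivAt (fun s : ℝ => g (y + s • d) v w) (G1 y d v w) 0)
    (hG2 : ∀ d e v w, HasDerivAt (fun s : ℝ => G1 (x + s • d) e v w) (G2 d e v w) 0)
    (u v a b c : V)
    (ha : ∀ w, g x a w = G1 x u u w - 1 / 2 * G1 x w u u)
    (hb : ∀ w, g x b w = 1 / 2 * (G1 x u v w + G1 x v u w - G1 x w u v))
    (hc : ∀ w, g x c w = G1 x v v w - 1 / 2 * G1 x w v v) :
    g x (riemannCurvature S g x u v v) u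
      = G2 u v v u - 1 / 2 * G2 u u v v - 1 / 2 * G2 v v u u + g x b b - g x a c := by
  have hgd : Differentiable ℝ g := hg.differentiable (by simp)
  have hinv := isInvertible_of_posDef hpos
  have hG1' : ∀ y d v w, fderiv ℝ g y d v w = G1 y d v w := by
    intro y d v w
    have h1 : HasDerivAt (fun s : ℝ => g (y + s • d)) (fderiv ℝ g y d) 0 :=
      (hgd y).hasFDerivAt.hasLineDerivAt d
    have h2 := (h1.clm_apply (hasDerivAt_const (0 : ℝ) v)).clm_apply (hasDerivAt_const (0 : ℝ) w)
    simp only [zero_smul, add_zero, map_zero] at h2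
    exact h2.unique (hG1 y d v w)
  have hlow : ∀ y v w t, lowerSymbol g v w y t
      = 1 / 2 * (G1 y v w t + G1 y w v t - G1 y t v w) := by
    intro y v w t
    simp [lowerSymbol, hG1']
  have hsymm1 : ∀ y d v w, G1 y d v w = G1 y d w v := by
    intro y d v w
    refine (hG1 y d v w).unique ?_
    simpa only [hsymm _ v w] using hG1 y d w v
  -- the Christoffel symbols near `x`
  let Γ : V → V → V → V := fun v w y => (g y).inverse (lowerSymbol g v w y)
  have hΓS : ∀ y ∈ S, ∀ v w, christoffel S g y v w = Γ v w y := by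
    intro y hy v w
    simp only [christoffel, Γ, christoffelLower_eq hS hg hy]
  have hΓd : ∀ v w, DifferentiableAt ℝ (Γ v w) x := by
    intro v w
    obtain ⟨e, he⟩ := hinv
    have h1 : DifferentiableAt ℝ (fun y => (g y).inverse) x := by
      have h2 : ContDiffAt ℝ 1 ContinuousLinearMap.inverse (g x) := by
        rw [← he]; exact contDiffAt_map_inverse e
      exact (h2.differentiableAt (by simp)).comp x (hgd x)
    exact h1.clm_apply (differentiable_lowerSymbol hg v w x)
  -- Positivity is assumed at `x` only; invertibility is an open condition, and the identity on a
  -- neighbourhood is all that differentiation needs.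
  have hΓg : ∀ᶠ y in nhds x, ∀ v w, g y (Γ v w y) = lowerSymbol g v w y := by
    have hopen : ∀ᶠ y in nhds x, (g y).IsInvertible := by
      obtain ⟨e, he⟩ := hinv
      have h1 : range ((↑) : (V ≃L[ℝ] (V →L[ℝ] ℝ)) → V →L[ℝ] V →L[ℝ] ℝ) ∈ nhds (g x) := by
        rw [← he]; exact ContinuousLinearEquiv.nhds e
      exact hg.continuous.continuousAt.preimage_mem_nhds h1
    filter_upwards [hopen] with y hy v w
    exact hy.self_apply_inverse _
  have hΓx : ∀ v w t, g x (Γ v w x) t = 1 / 2 * (G1 x v w t + G1 x w v t - G1 x t v w) := by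
    intro v w t
    rw [hΓg.self_of_nhds v w, hlow]
  have hinj : ∀ p q : V, (∀ t, g x p t = g x q t) → p = q := by
    intro p q h
    by_contra hne
    have h1 := hpos (p - q) (sub_ne_zero.2 hne)
    rw [(g x).map_sub, sub_apply, h, sub_self] at h1
    exact h1.false
  have haΓ : Γ u u x = a := hinj _ _ fun t => by rw [hΓx, ha]; ring
  have hbΓ : Γ u v x = b := hinj _ _ fun t => by rw [hΓx, hb]
  have hcΓ : Γ v v x = c := hinj _ _ fun t => by rw [hΓx, hc]; ring
  have hder : ∀ v w d t, g x (fderiv ℝ (Γ v w) x d) t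
      = 1 / 2 * (G2 d v w t + G2 d w v t - G2 d t v w) - G1 x d (Γ v w x) t := by
    intro v w d t
    have h1 : HasDerivAt (fun s : ℝ => g (x + s • d)) (fderiv ℝ g x d) 0 :=
      (hgd x).hasFDerivAt.hasLineDerivAt d
    have h0 : HasDerivAt (fun s : ℝ => Γ v w (x + s • d)) (fderiv ℝ (Γ v w) x d) 0 :=
      (hΓd v w).hasFDerivAt.hasLineDerivAt d
    have h2 := (h1.clm_apply h0).clm_apply (hasDerivAt_const (0 : ℝ) t)
    have h3 : HasDerivAt (fun s : ℝ => lowerSymbol g v w (x + s • d) t)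
        (1 / 2 * (G2 d v w t + G2 d w v t - G2 d t v w)) 0 := by
      simp only [hlow]
      exact (((hG2 d v w t).add (hG2 d w v t)).sub (hG2 d t v w)).const_mul _
    have h4 : (fun s : ℝ => g (x + s • d) (Γ v w (x + s • d)) t)
        =ᶠ[nhds 0] fun s : ℝ => lowerSymbol g v w (x + s • d) t := by
      have : Filter.Tendsto (fun s : ℝ => x + s • d) (nhds 0) (nhds x) := by
        have hc : Continuous fun s : ℝ => x + s • d := by fun_prop
        simpa using hc.tendsto 0
      filter_upwards [this.eventually hΓg] with s hs
      rw [hs]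
    have h5 := (h3.congr_of_eventuallyEq h4).unique h2
    simp only [zero_smul, add_zero, map_zero, add_apply,
      hG1'] at h5
    linarith
  have hfw : ∀ v w d, fderivWithin ℝ (fun y => christoffel S g y v w) S x d
      = fderiv ℝ (Γ v w) x d := by
    intro v w d
    rw [fderivWithin_congr (fun y hy => hΓS y hy v w) (hΓS x hx v w),
      (hΓd v w).fderivWithin (hS x hx)]
  have hsymm2 : ∀ d e v w, G2 d e v w = G2 d e w v := by
    intro d e v w
    refine (hG2 d e v w).unique ?_
    simpa only [hsymm1 _ e v w] using hG2 d e w v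
  rw [riemannCurvature, hfw, hfw]
  simp only [hΓS x hx, map_add, map_sub, add_apply,
    sub_apply, hder, hΓx]
  simp only [hbΓ, hcΓ]
  have e1 := hb b
  have e2 := ha c
  have e3 := hsymm1 x u c u
  have e4 := hsymm1 x v b u
  have e5 := hsymm1 x b v u
  have e6 := hsymm2 v u u v
  linarith

end GeneralCurvature

/-! ### The Kähler geometry of the base in the coordinate `z` -/

section CoreGeometry

variable {H : Type*} [NormedAddCommGroup H] [InnerProductSpace ℂ H]

/-- The real part of the Hermitian inner product, as a real bilinear form. -/
def reForm : H →L[ℝ] H →L[ℝ] ℝ :=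
  LinearMap.mkContinuous₂
    (LinearMap.mk₂ ℝ (fun u v : H => (inner ℂ u v).re)
      (fun u u' v => by simp [inner_add_left]) (fun c u v => by simp [inner_smul_left_eq_smul])
      (fun u v v' => by simp [inner_add_right]) (fun c u v => by simp [inner_smul_right_eq_smul]))
    1 fun u v => by
      simpa using (Complex.abs_re_le_norm _).trans (norm_inner_le_norm u v)

/-- The imaginary part of the Hermitian inner product, as a real bilinear form. -/
def imForm : H →L[ℝ] H →L[ℝ] ℝ :=
  LinearMap.mkContinuous₂
    (LinearMap.mk₂ ℝ (fun u v : H => (inner ℂ u v).im)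
      (fun u u' v => by simp [inner_add_left]) (fun c u v => by simp [inner_smul_left_eq_smul])
      (fun u v v' => by simp [inner_add_right]) (fun c u v => by simp [inner_smul_right_eq_smul]))
    1 fun u v => by
      simpa using (Complex.abs_im_le_norm _).trans (norm_inner_le_norm u v)

theorem reForm_apply (u v : H) : reForm u v = (inner ℂ u v).re := rfl

theorem imForm_apply (u v : H) : imForm u v = (inner ℂ u v).im := rfl

theorem reForm_comm (u v : H) : reForm u v = reForm v u := by
  rw [reForm_apply, reForm_apply, ← inner_conj_symm, Complex.conj_re]

theorem imForm_comm (u v : H) : imForm u v = -imForm v u := by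
  rw [imForm_apply, imForm_apply, ← inner_conj_symm, Complex.conj_im]

theorem imForm_self (u : H) : imForm u u = 0 := by
  linarith [imForm_comm u u]

theorem reForm_self (u : H) : reForm u u = ‖u‖ ^ 2 := by
  have h := inner_self_eq_norm_sq_to_K (𝕜 := ℂ) u
  rw [reForm_apply, h]
  norm_cast

theorem reForm_I_left (u v : H) : reForm (Complex.I • u) v = imForm u v := by
  simp [reForm_apply, imForm_apply, inner_smul_left]

theorem reForm_I_right (u v : H) : reForm u (Complex.I • v) = -imForm u v := by
  simp [reForm_apply, imForm_apply, inner_smul_right]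

theorem imForm_I_left (u v : H) : imForm (Complex.I • u) v = -reForm u v := by
  simp [reForm_apply, imForm_apply, inner_smul_left]

theorem imForm_I_right (u v : H) : imForm u (Complex.I • v) = reForm u v := by
  simp [reForm_apply, imForm_apply, inner_smul_right]

/-- The weight `1 / (1 + ‖z‖²)`. -/
def weight (z : H) : ℝ := (1 + ‖z‖ ^ 2)⁻¹

theorem weight_pos (z : H) : 0 < weight z := by unfold weight; positivity

theorem weight_mul (z : H) : weight z * (1 + reForm z z) = 1 := by
  rw [reForm_self, weight]
  exact inv_mul_cancel₀ (by positivity)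

/-- The metric of `ℂℍ^m` in the coordinate `z`. -/
def coreForm (z u v : H) : ℝ :=
  reForm u v - weight z * (reForm z u * reForm z v) + imForm z u * imForm z v

/-- The derivative of `coreForm z u v` in the direction `d`. -/
def coreForm1 (z d u v : H) : ℝ :=
  -weight z * (reForm d u * reForm z v + reForm z u * reForm d v)
    + 2 * weight z ^ 2 * reForm z d * reForm z u * reForm z v
    + imForm d u * imForm z v + imForm z u * imForm d v

/-- The derivative of `coreForm1 z e u v` in the direction `d`. -/
def coreForm2 (z d e u v : H) : ℝ :=
  2 * weight z ^ 2 * reForm z d * (reForm e u * reForm z v + reForm z u * reForm e v)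
    - weight z * (reForm e u * reForm d v + reForm d u * reForm e v)
    - 8 * weight z ^ 3 * reForm z d * reForm z e * reForm z u * reForm z v
    + 2 * weight z ^ 2 * (reForm d e * reForm z u * reForm z v
      + reForm z e * reForm d u * reForm z v + reForm z e * reForm z u * reForm d v)
    + imForm e u * imForm d v + imForm d u * imForm e v

/-- The symmetric part of the covariant derivative of the form `imForm z`, up to sign. -/
def coreTwist (z u v : H) : ℝ :=
  weight z * (imForm z v * reForm z u + imForm z u * reForm z v)

/-- The Christoffel symbols of `coreForm`. -/
def coreChristoffel (z u v : H) : H :=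
  imForm z v • (Complex.I • u) + imForm z u • (Complex.I • v)
    - (reForm u v - weight z * (reForm z u * reForm z v) + 2 * imForm z u * imForm z v) • z
    - coreTwist z u v • (Complex.I • z)

/-- The complex structure for which `coreForm` is a Kähler metric. -/
def coreJ (z u : H) : H :=
  Complex.I • u - imForm z u • z - (weight z * reForm z u) • (Complex.I • z)

/-- The vector dual to the form `imForm z`. -/
def coreSharp (z : H) : H := weight z • (Complex.I • z)

theorem coreForm_comm (z u v : H) : coreForm z u v = coreForm z v u := by
  simp only [coreForm, reForm_comm u v]; ring

theorem coreForm_christoffel (z u v w : H) : coreForm z (coreChristoffel z u v) w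
    = 1 / 2 * (coreForm1 z u v w + coreForm1 z v u w - coreForm1 z w u v) := by
  have hk := weight_mul z
  -- `weight z` and `‖z‖²` are dependent; eliminating the norm leaves a rational identity in `weight
  -- z` and independent pairings.
  have hm : reForm z z = (weight z)⁻¹ - 1 := by
    field_simp [(weight_pos z).ne']; linarith
  simp only [coreForm, coreForm1, coreChristoffel, coreTwist, map_add, map_sub, map_smul, add_apply,
    sub_apply, smul_apply, smul_eq_mul, reForm_I_left, reForm_I_right, imForm_I_left,
    imForm_I_right, imForm_self, hm, reForm_comm u z, imForm_comm u z, reForm_comm v z,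
    imForm_comm v z, reForm_comm w z, imForm_comm w z, reForm_comm w u, imForm_comm w u,
    reForm_comm w v, imForm_comm w v, reForm_comm v u, imForm_comm v u]
  have := (weight_pos z).ne'
  field_simp
  ring

theorem coreForm_J_left (z u w : H) : coreForm z (coreJ z u) w = imForm u w := by
  have hk := weight_mul z
  have hm : reForm z z = (weight z)⁻¹ - 1 := by
    field_simp [(weight_pos z).ne']; linarith
  simp only [coreForm, coreJ, map_add, map_sub, map_smul, add_apply,
    sub_apply, smul_apply, smul_eq_mul, reForm_I_left, reForm_I_right, imForm_I_left,
    imForm_I_right, imForm_self, hm]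
  have := (weight_pos z).ne'
  field_simp
  ring

theorem imForm_J_right (z u v : H) : imForm u (coreJ z v) = coreForm z u v := by
  simp only [coreForm, coreJ, map_add, map_sub, map_smul, add_apply,
    sub_apply, smul_apply, smul_eq_mul, reForm_I_left, reForm_I_right, imForm_I_left,
    imForm_I_right, imForm_self, reForm_comm u z, imForm_comm u z]
  ring

theorem coreForm_sharp (z w : H) : coreForm z (coreSharp z) w = imForm z w := by
  have hk := weight_mul z
  have hm : reForm z z = (weight z)⁻¹ - 1 := by
    field_simp [(weight_pos z).ne']; linarith
  simp only [coreForm, coreSharp, map_smul, smul_apply, smul_eq_mul, reForm_I_left, reForm_I_right,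
    imForm_I_left, imForm_I_right, imForm_self, hm]
  have := (weight_pos z).ne'
  field_simp
  ring

theorem coreForm_self_left (z w : H) : coreForm z z w = weight z * reForm z w := by
  have hk := weight_mul z
  simp only [coreForm, imForm_self]
  linear_combination (-reForm z w) * hk

/-- The derivative of `β(v)` along `u` is `imForm u v`, which is antisymmetric, so the symmetric
part of `∇β` comes only from this Christoffel term. -/
theorem imForm_christoffel (z u v : H) : imForm z (coreChristoffel z u v) = coreTwist z u v := by
  have hk := weight_mul z
  simp only [coreChristoffel, coreTwist, map_add, map_sub, map_smul, smul_eq_mul, imForm_I_right,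
    imForm_self]
  linear_combination (-(imForm z v * reForm z u + imForm z u * reForm z v)) * hk

/-- The Kähler form is parallel; as its coefficients are constant, only the Christoffel terms
appear. -/
theorem imForm_christoffel_add (z w u v : H) :
    imForm (coreChristoffel z w u) v + imForm u (coreChristoffel z w v) = 0 := by
  simp only [coreChristoffel, coreTwist, map_add, map_sub, map_smul, add_apply,
    sub_apply, smul_apply, smul_eq_mul, reForm_I_left, reForm_I_right, imForm_I_left,
    imForm_I_right, reForm_comm u z, imForm_comm u z, reForm_comm u w, imForm_comm u w]
  ring

/-- This is constant holomorphic sectional curvature `-4`, in the shape produced by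
`metric_riemannCurvature`. -/
theorem coreForm_curvature (z u v : H) :
    coreForm2 z u v v u - 1 / 2 * coreForm2 z u u v v - 1 / 2 * coreForm2 z v v u u
      + coreForm z (coreChristoffel z u v) (coreChristoffel z u v)
      - coreForm z (coreChristoffel z u u) (coreChristoffel z v v)
      = -(coreForm z u u * coreForm z v v - coreForm z u v ^ 2 + 3 * imForm u v ^ 2) := by
  have hk := weight_mul z
  have hm : reForm z z = (weight z)⁻¹ - 1 := by
    field_simp [(weight_pos z).ne']; linarith
  simp only [coreForm, coreForm2, coreChristoffel, coreTwist, map_add, map_sub, map_smul, add_apply,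
    sub_apply, smul_apply, smul_eq_mul, reForm_I_left, reForm_I_right, imForm_I_left,
    imForm_I_right, imForm_self, hm, reForm_comm u z, imForm_comm u z, reForm_comm v z,
    imForm_comm v z, reForm_comm v u, imForm_comm v u]
  have := (weight_pos z).ne'
  field_simp
  ring

theorem coreForm_self_pos (z : H) {u : H} (hu : u ≠ 0) : 0 < coreForm z u u := by
  have h1 : reForm z u ^ 2 ≤ ‖z‖ ^ 2 * ‖u‖ ^ 2 := by
    rw [← mul_pow]
    exact sq_le_sq' (abs_le.1 ((Complex.abs_re_le_norm _).trans (norm_inner_le_norm z u))).1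
      ((Complex.re_le_norm _).trans (norm_inner_le_norm z u))
  have h2 := weight_pos z
  have h3 := weight_mul z
  have h4 : 0 < ‖u‖ ^ 2 := by positivity
  rw [reForm_self] at h3
  -- The relation `weight z * (1 + ‖z‖²) = 1` splits the form into a positive term, a Cauchy–Schwarz
  -- defect and a square.
  have h5 : coreForm z u u = weight z * ‖u‖ ^ 2
      + weight z * (‖z‖ ^ 2 * ‖u‖ ^ 2 - reForm z u ^ 2) + imForm z u ^ 2 := by
    simp only [coreForm, reForm_self]
    linear_combination (-‖u‖ ^ 2) * h3
  rw [h5]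
  have h6 := mul_pos h2 h4
  have h7 := mul_nonneg h2.le (sub_nonneg.2 h1)
  positivity

end CoreGeometry

/-! ### Linearity and pairings of the base tensors -/

section CoreBilinear

variable {H : Type*} [NormedAddCommGroup H] [InnerProductSpace ℂ H] (z : H)

theorem coreForm_add_left (u u' v : H) :
    coreForm z (u + u') v = coreForm z u v + coreForm z u' v := by
  simp only [coreForm, map_add, add_apply]; ring

theorem coreForm_sub_left (u u' v : H) :
    coreForm z (u - u') v = coreForm z u v - coreForm z u' v := by
  simp only [coreForm, map_sub, sub_apply]; ring

theorem coreForm_smul_left (c : ℝ) (u v : H) : coreForm z (c • u) v = c * coreForm z u v := by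
  simp only [coreForm, map_smul, smul_apply, smul_eq_mul]; ring

theorem coreForm_add_right (u v v' : H) :
    coreForm z u (v + v') = coreForm z u v + coreForm z u v' := by
  simp only [coreForm, map_add]; ring

theorem coreForm_sub_right (u v v' : H) :
    coreForm z u (v - v') = coreForm z u v - coreForm z u v' := by
  simp only [coreForm, map_sub]; ring

theorem coreForm_smul_right (c : ℝ) (u v : H) : coreForm z u (c • v) = c * coreForm z u v := by
  simp only [coreForm, map_smul, smul_eq_mul]; ring

theorem coreForm1_comm (d u v : H) : coreForm1 z d u v = coreForm1 z d v u := by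
  simp only [coreForm1]; ring

theorem coreTwist_sub_smul (c c' : ℝ) (u u' v : H) : coreTwist z (c • u - c' • u') v
    = c * coreTwist z u v - c' * coreTwist z u' v := by
  simp only [coreTwist, map_sub, map_smul, smul_eq_mul]; ring

theorem coreTwist_comm (u v : H) : coreTwist z u v = coreTwist z v u := by
  simp only [coreTwist]; ring

theorem imForm_J (u : H) : imForm u (coreJ z u) = coreForm z u u := imForm_J_right z u u

theorem coreForm_J_right (u w : H) : coreForm z w (coreJ z u) = imForm u w := by
  rw [coreForm_comm, coreForm_J_left]

theorem coreForm_sharp_right (w : H) : coreForm z w (coreSharp z) = imForm z w := by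
  rw [coreForm_comm, coreForm_sharp]

theorem imForm_sharp (u : H) : imForm u (coreSharp z) = weight z * reForm z u := by
  rw [coreSharp, map_smul, smul_eq_mul, imForm_I_right, reForm_comm]

theorem imForm_base_J (u : H) : imForm z (coreJ z u) = weight z * reForm z u := by
  rw [imForm_J_right, coreForm_self_left]

theorem coreChristoffel_comm (u v : H) : coreChristoffel z u v = coreChristoffel z v u := by
  simp only [coreChristoffel, coreTwist_comm z u v, reForm_comm u v, mul_comm (reForm z u),
    mul_assoc, mul_comm (imForm z u)]
  abel

end CoreBilinear

/-! ### The warped metric, its Christoffel symbols and its curvature -/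

section Warped

variable {H : Type*} [NormedAddCommGroup H] [InnerProductSpace ℂ H]

/-- The form `dθ + φ(r) β`, where `β = imForm z` is the connection form. -/
def angular (φ : ℝ → ℝ) (p u : H × ℝ × ℝ) : ℝ := u.2.1 + φ p.2.2 * imForm p.1 u.1

/-- The derivative of `angular φ p u` in the direction `d`. -/
def angular1 (φ : ℝ → ℝ) (p d u : H × ℝ × ℝ) : ℝ :=
  deriv φ p.2.2 * d.2.2 * imForm p.1 u.1 + φ p.2.2 * imForm d.1 u.1

/-- The derivative of `angular1 φ p e u` in the direction `d`. -/
def angular2 (φ : ℝ → ℝ) (p d e u : H × ℝ × ℝ) : ℝ :=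
  deriv (deriv φ) p.2.2 * d.2.2 * e.2.2 * imForm p.1 u.1 + deriv φ p.2.2 * e.2.2 * imForm d.1 u.1
    + deriv φ p.2.2 * d.2.2 * imForm e.1 u.1

/-- The metric `cosh²(r) 𝔠 + B(r)² (dθ + φ(r) β)² + dr²`. -/
def warpForm (B φ : ℝ → ℝ) (p u v : H × ℝ × ℝ) : ℝ :=
  Real.cosh p.2.2 ^ 2 * coreForm p.1 u.1 v.1 + B p.2.2 ^ 2 * (angular φ p u * angular φ p v)
    + u.2.2 * v.2.2

/-- The derivative of `warpForm B φ p u v` in the direction `d`. -/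
def warpForm1 (B φ : ℝ → ℝ) (p d u v : H × ℝ × ℝ) : ℝ :=
  2 * Real.cosh p.2.2 * Real.sinh p.2.2 * d.2.2 * coreForm p.1 u.1 v.1
    + Real.cosh p.2.2 ^ 2 * coreForm1 p.1 d.1 u.1 v.1
    + 2 * B p.2.2 * deriv B p.2.2 * d.2.2 * (angular φ p u * angular φ p v)
    + B p.2.2 ^ 2 * (angular1 φ p d u * angular φ p v + angular φ p u * angular1 φ p d v)

/-- The derivative of `warpForm1 B φ p e u v` in the direction `d`. -/
def warpForm2 (B φ : ℝ → ℝ) (p d e u v : H × ℝ × ℝ) : ℝ :=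
  2 * (Real.sinh p.2.2 ^ 2 + Real.cosh p.2.2 ^ 2) * d.2.2 * e.2.2 * coreForm p.1 u.1 v.1
    + 2 * Real.cosh p.2.2 * Real.sinh p.2.2 * (e.2.2 * coreForm1 p.1 d.1 u.1 v.1
      + d.2.2 * coreForm1 p.1 e.1 u.1 v.1)
    + Real.cosh p.2.2 ^ 2 * coreForm2 p.1 d.1 e.1 u.1 v.1
    + 2 * (deriv B p.2.2 ^ 2 + B p.2.2 * deriv (deriv B) p.2.2) * d.2.2 * e.2.2
      * (angular φ p u * angular φ p v)
    + 2 * B p.2.2 * deriv B p.2.2 * e.2.2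
      * (angular1 φ p d u * angular φ p v + angular φ p u * angular1 φ p d v)
    + 2 * B p.2.2 * deriv B p.2.2 * d.2.2
      * (angular1 φ p e u * angular φ p v + angular φ p u * angular1 φ p e v)
    + B p.2.2 ^ 2 * (angular2 φ p d e u * angular φ p v + angular1 φ p e u * angular1 φ p d v
      + angular1 φ p d u * angular1 φ p e v + angular φ p u * angular2 φ p d e v)

/-- The component in `H` of the Christoffel symbols of `warpForm`. -/
def warpChristoffelBase (B φ : ℝ → ℝ) (p u v : H × ℝ × ℝ) : H :=
  coreChristoffel p.1 u.1 v.1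
    + (Real.sinh p.2.2 / Real.cosh p.2.2) • (u.2.2 • v.1 + v.2.2 • u.1)
    + ((B p.2.2 / Real.cosh p.2.2) ^ 2 * φ p.2.2) •
      (angular φ p v • coreJ p.1 u.1 + angular φ p u • coreJ p.1 v.1)
    + (1 / 2 * (B p.2.2 / Real.cosh p.2.2) ^ 2 * deriv φ p.2.2
      * (angular φ p v * u.2.2 + angular φ p u * v.2.2)) • coreSharp p.1

/-- The value of `dθ + φ β` on the Christoffel symbols of `warpForm`. -/
def warpChristoffelAngular (B φ : ℝ → ℝ) (p u v : H × ℝ × ℝ) : ℝ :=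
  1 / 2 * deriv φ p.2.2 * (u.2.2 * imForm p.1 v.1 + v.2.2 * imForm p.1 u.1)
    + deriv B p.2.2 / B p.2.2 * (u.2.2 * angular φ p v + v.2.2 * angular φ p u)

/-- The radial component of the Christoffel symbols of `warpForm`. -/
def warpChristoffelRadial (B φ : ℝ → ℝ) (p u v : H × ℝ × ℝ) : ℝ :=
  -Real.cosh p.2.2 * Real.sinh p.2.2 * coreForm p.1 u.1 v.1
    - B p.2.2 * deriv B p.2.2 * angular φ p u * angular φ p v
    - 1 / 2 * B p.2.2 ^ 2 * deriv φ p.2.2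
      * (angular φ p v * imForm p.1 u.1 + angular φ p u * imForm p.1 v.1)

/-- The Christoffel symbols of `warpForm`. -/
def warpChristoffel (B φ : ℝ → ℝ) (p u v : H × ℝ × ℝ) : H × ℝ × ℝ :=
  (warpChristoffelBase B φ p u v,
    warpChristoffelAngular B φ p u v - φ p.2.2 * imForm p.1 (warpChristoffelBase B φ p u v),
    warpChristoffelRadial B φ p u v)

theorem warpForm_christoffel (B φ : ℝ → ℝ) (p u v w : H × ℝ × ℝ) (hB : B p.2.2 ≠ 0) :
    warpForm B φ p (warpChristoffel B φ p u v) w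
      = 1 / 2 * (warpForm1 B φ p u v w + warpForm1 B φ p v u w - warpForm1 B φ p w u v) := by
  have hη : angular φ p (warpChristoffel B φ p u v) = warpChristoffelAngular B φ p u v := by
    simp only [angular, warpChristoffel]; ring
  have hA : Real.cosh p.2.2 ≠ 0 := (Real.cosh_pos _).ne'
  rw [warpForm, hη]
  simp only [warpChristoffel, warpChristoffelBase, coreForm_add_left, coreForm_smul_left,
    coreForm_christoffel, coreForm_J_left, coreForm_sharp, warpChristoffelAngular,
    warpChristoffelRadial, warpForm1, angular1, imForm_comm w.1, coreForm_comm _ w.1]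
  generalize angular φ p u = a
  generalize angular φ p v = a'
  generalize angular φ p w = a''
  rw [imForm_comm v.1 u.1]
  field_simp
  ring

/-- The bivector `u ∧ v` enters through its base part `u.1 ∧ v.1`, its contractions `w` and `s` with
`dθ + φβ` and `dr`, and its vertical component `δ`, up to signs. All scalars are named so that the
final identity is purely algebraic. -/
theorem warpForm_curvature (B φ : ℝ → ℝ) (p u v : H × ℝ × ℝ) (hB : B p.2.2 ≠ 0)
    {A S B0 B1 B2 f f1 f2 a a' : ℝ} (hA : Real.cosh p.2.2 = A) (hS : Real.sinh p.2.2 = S)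
    (hB0 : B p.2.2 = B0) (hB1 : deriv B p.2.2 = B1) (hB2 : deriv (deriv B) p.2.2 = B2)
    (hf : φ p.2.2 = f) (hf1 : deriv φ p.2.2 = f1) (hf2 : deriv (deriv φ) p.2.2 = f2)
    (ha : angular φ p u = a) (ha' : angular φ p v = a')
    {w s : H} (hw : w = a' • u.1 - a • v.1) (hs : s = u.2.2 • v.1 - v.2.2 • u.1)
    {δ : ℝ} (hδ : δ = a' * u.2.2 - a * v.2.2) :
    warpForm2 B φ p u v v u - 1 / 2 * warpForm2 B φ p u u v v - 1 / 2 * warpForm2 B φ p v v u u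
      + warpForm B φ p (warpChristoffel B φ p u v) (warpChristoffel B φ p u v)
      - warpForm B φ p (warpChristoffel B φ p u u) (warpChristoffel B φ p v v)
    = -(A ^ 2 * (coreForm p.1 u.1 u.1 * coreForm p.1 v.1 v.1 - coreForm p.1 u.1 v.1 ^ 2
          + 3 * imForm u.1 v.1 ^ 2))
      - (A * S) ^ 2 * (coreForm p.1 u.1 u.1 * coreForm p.1 v.1 v.1 - coreForm p.1 u.1 v.1 ^ 2)
      - A ^ 2 * coreForm p.1 s s
      - 3 / 4 * B0 ^ 2 * (2 * f * imForm u.1 v.1 + f1 * imForm p.1 s) ^ 2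
      - B0 * B2 * δ ^ 2 - B0 * B1 * A * S * coreForm p.1 w w
      + 1 / 4 * (B0 ^ 4 / A ^ 2 * (4 * f ^ 2 * coreForm p.1 w w
          + 4 * f * f1 * δ * imForm p.1 (coreJ p.1 w)
          + f1 ^ 2 * δ ^ 2 * imForm p.1 (coreSharp p.1))
        + B0 ^ 4 * f1 ^ 2 * imForm p.1 w ^ 2)
      - B0 ^ 2 * (3 * f1 * δ * imForm u.1 v.1 - f1 * coreTwist p.1 w s + f2 * δ * imForm p.1 s
        - 6 * f * (S / A) * δ * imForm u.1 v.1
        + f1 * A * S * (coreForm p.1 w u.1 * imForm p.1 v.1 - coreForm p.1 w v.1 * imForm p.1 u.1)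
        - f1 * (S / A) * δ * imForm p.1 s)
      - 3 * B0 * B1 * δ * (2 * f * imForm u.1 v.1 + f1 * imForm p.1 s) := by
  have hη : ∀ v w, angular φ p (warpChristoffel B φ p v w) = warpChristoffelAngular B φ p v w := by
    intro v w
    simp only [angular, warpChristoffel]; ring
  have hA0 : A ≠ 0 := hA ▸ (Real.cosh_pos _).ne'
  have hcurv := coreForm_curvature p.1 u.1 v.1
  obtain ⟨x, t, b⟩ := u
  obtain ⟨y, t', b'⟩ := v
  set z := p.1 with hz
  simp only at hcurv hw hs hδ
  have g1 := coreForm_christoffel z x y x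
  have g2 := coreForm_christoffel z x y y
  have g3 := coreForm_christoffel z x x x
  have g4 := coreForm_christoffel z x x y
  have g5 := coreForm_christoffel z y y x
  have g6 := coreForm_christoffel z y y y
  have c1 := (coreForm_comm z x (coreChristoffel z x y)).trans g1
  have c2 := (coreForm_comm z y (coreChristoffel z x y)).trans g2
  have c3 := (coreForm_comm z x (coreChristoffel z x x)).trans g3
  have c4 := (coreForm_comm z y (coreChristoffel z x x)).trans g4
  have c5 := (coreForm_comm z x (coreChristoffel z y y)).trans g5
  have c6 := (coreForm_comm z y (coreChristoffel z y y)).trans g6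
  -- Since the Kähler form is parallel, its pairings with `Γ(x, x)` and `Γ(y, y)` reduce to pairings
  -- with `Γ(x, y)`.
  have q1 : imForm y (coreChristoffel z x x) = imForm x (coreChristoffel z x y) := by
    linarith [imForm_christoffel_add z x x y, imForm_comm y (coreChristoffel z x x)]
  have q2 : imForm x (coreChristoffel z y y) = imForm y (coreChristoffel z x y) := by
    have h := imForm_christoffel_add z y x y
    rw [coreChristoffel_comm z y x] at h
    linarith [imForm_comm y (coreChristoffel z x y)]
  have yx := coreForm_comm z y x
  have iyx := imForm_comm y x
  have d1 := fun d => coreForm1_comm z d y x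
  have ew : coreForm z w w
      = a' ^ 2 * coreForm z x x - 2 * a * a' * coreForm z x y + a ^ 2 * coreForm z y y := by
    rw [hw]
    simp only [coreForm_sub_left, coreForm_sub_right, coreForm_smul_left, coreForm_smul_right, yx]
    ring
  have es : coreForm z s s
      = b ^ 2 * coreForm z y y - 2 * b * b' * coreForm z x y + b' ^ 2 * coreForm z x x := by
    rw [hs]
    simp only [coreForm_sub_left, coreForm_sub_right, coreForm_smul_left, coreForm_smul_right, yx]
    ring
  have iw : imForm z w = a' * imForm z x - a * imForm z y := by
    rw [hw]; simp
  have is : imForm z s = b * imForm z y - b' * imForm z x := by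
    rw [hs]; simp
  have rw' : reForm z w = a' * reForm z x - a * reForm z y := by
    rw [hw]; simp
  have wx : coreForm z w x = a' * coreForm z x x - a * coreForm z x y := by
    rw [hw]
    simp only [coreForm_sub_left, coreForm_smul_left, yx]
  have wy : coreForm z w y = a' * coreForm z x y - a * coreForm z y y := by
    rw [hw]
    simp only [coreForm_sub_left, coreForm_smul_left]
  have tws : coreTwist z w s = a' * (b * coreTwist z x y - b' * coreTwist z x x)
      - a * (b * coreTwist z y y - b' * coreTwist z x y) := by
    rw [hw, hs, coreTwist_sub_smul, coreTwist_comm z x, coreTwist_comm z y, coreTwist_sub_smul,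
      coreTwist_sub_smul, coreTwist_comm z y x]
  simp only [warpForm, warpForm2, hη, warpChristoffelAngular, warpChristoffelRadial, angular1,
    angular2, ha, ha', hA, hS, hB0, hB1, hB2, hf, hf1, hf2, ← hz, imForm_self, iyx, yx, d1, ew, es,
    iw, is, wx, wy, tws, imForm_base_J, imForm_sharp, rw', hδ]
  simp only [warpChristoffel, warpChristoffelBase, ha, ha', hA, hS, hB0, hf, hf1, ← hz,
    coreForm_add_left, coreForm_add_right, coreForm_smul_left, coreForm_smul_right,
    coreForm_J_left, coreForm_J_right, coreForm_sharp, coreForm_sharp_right, imForm_J_right,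
    imForm_sharp, imForm_base_J, imForm_christoffel, g1, g2, g3, g4, g5, g6, c1, c2, c3, c4, c5, c6,
    q1, q2, imForm_self, iyx, yx, d1]
  simp only [warpChristoffelRadial, ha, ha', hA, hS, hB0, hB1, hf1, ← hz, map_add, map_smul,
    smul_eq_mul, imForm_J_right, imForm_sharp, imForm_base_J, imForm_christoffel, q1, q2,
    imForm_self, iyx, yx, coreForm_self_left]
  have hB0' : B0 ≠ 0 := hB0 ▸ hB
  -- Taking the ratios `S/A`, `B0/A`, `B1/B0` as variables removes every division. The identity is
  -- then polynomial modulo the base curvature, which enters with factor `A²`.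
  obtain ⟨L, rfl⟩ : ∃ L, S = L * A := ⟨S / A, by field_simp⟩
  obtain ⟨k, rfl⟩ : ∃ k, B0 = k * A := ⟨B0 / A, by field_simp⟩
  obtain ⟨l, rfl⟩ : ∃ l, B1 = l * (k * A) := ⟨B1 / (k * A), (div_mul_cancel₀ _ hB0').symm⟩
  have r1 : L * A / A = L := by field_simp
  have r2 : k * A / A = k := by field_simp
  have r3 : l * (k * A) / (k * A) = l := mul_div_cancel_right₀ _ hB0'
  have r4 : (k * A) ^ 4 / A ^ 2 = k ^ 4 * A ^ 2 := by field_simp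
  rw [r1, r2, r3, r4]
  linear_combination A ^ 2 * hcurv

end Warped

/-! ### Norm bounds on the base -/

section CoreInequalities

variable {H : Type*} [NormedAddCommGroup H] [InnerProductSpace ℂ H] (z : H)

theorem coreForm_self_nonneg (u : H) : 0 ≤ coreForm z u u := by
  by_cases h : u = 0
  · simp [h, coreForm]
  · exact (coreForm_self_pos z h).le

theorem coreForm_cauchySchwarz (u v : H) :
    coreForm z u v ^ 2 ≤ coreForm z u u * coreForm z v v := by
  by_cases h : u = 0
  · simp [h, coreForm]
  have h1 := coreForm_self_pos z h
  have h2 := coreForm_self_nonneg z (coreForm z u u • v - coreForm z u v • u)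
  have h3 : coreForm z (coreForm z u u • v - coreForm z u v • u)
      (coreForm z u u • v - coreForm z u v • u)
      = coreForm z u u * (coreForm z u u * coreForm z v v - coreForm z u v ^ 2) := by
    simp only [coreForm_sub_left, coreForm_sub_right, coreForm_smul_left, coreForm_smul_right,
      coreForm_comm z v u]
    ring
  rw [h3] at h2
  linarith [nonneg_of_mul_nonneg_right h2 h1]

theorem coreForm_wedge_nonneg (u v : H) :
    0 ≤ coreForm z u u * coreForm z v v - coreForm z u v ^ 2 := by
  linarith [coreForm_cauchySchwarz z u v]

/-- Contracting a bivector with a vector `e` does not increase its norm by more than the norm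
of `e`. -/
theorem coreForm_contract_le (e u v : H) :
    coreForm z (coreForm z e v • u - coreForm z e u • v) (coreForm z e v • u - coreForm z e u • v)
      ≤ coreForm z e e * (coreForm z u u * coreForm z v v - coreForm z u v ^ 2) := by
  set D := coreForm z (coreForm z e v • u - coreForm z e u • v)
    (coreForm z e v • u - coreForm z e u • v) with hD
  have hDe : D = coreForm z e v ^ 2 * coreForm z u u
      - 2 * coreForm z e u * coreForm z e v * coreForm z u v
      + coreForm z e u ^ 2 * coreForm z v v := by
    simp only [hD, coreForm_sub_left, coreForm_sub_right, coreForm_smul_left, coreForm_smul_right,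
      coreForm_comm z v u]
    ring
  have hW := coreForm_wedge_nonneg z u v
  set W := coreForm z u u * coreForm z v v - coreForm z u v ^ 2 with hWdef
  -- When `W > 0`, `f` is `W` times the orthogonal projection of `e` to the span of `u`, `v`.
  -- Cauchy–Schwarz for `e` and `f` reads `D² ≤ |e|² W D`, and `D` cancels.
  let f : H := (coreForm z v v * coreForm z e u - coreForm z u v * coreForm z e v) • u
    + (coreForm z u u * coreForm z e v - coreForm z u v * coreForm z e u) • v
  have h1 : coreForm z e f = D := by
    simp only [f, coreForm_add_right, coreForm_smul_right, hDe]; ring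
  have h2 : coreForm z f f = W * D := by
    simp only [f, coreForm_add_left, coreForm_add_right, coreForm_smul_left, coreForm_smul_right,
      coreForm_comm z v u, hDe, hWdef]
    ring
  have h3 := coreForm_cauchySchwarz z e f
  rw [h1, h2] at h3
  have hD0 : 0 ≤ D := coreForm_self_nonneg z _
  have hee := coreForm_self_nonneg z e
  by_contra! h
  have : 0 < D := lt_of_le_of_lt (mul_nonneg hee hW) h
  nlinarith

/-- Wirtinger's inequality: contracting `u ∧ v` with `J u`, which is orthogonal to `u` and of the
same length, gives `imForm u v • u`. -/
theorem imForm_sq_le_wedge (u v : H) :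
    imForm u v ^ 2 ≤ coreForm z u u * coreForm z v v - coreForm z u v ^ 2 := by
  by_cases h : u = 0
  · simp [h, coreForm]
  have h1 := coreForm_self_pos z h
  have h2 := coreForm_contract_le z (coreJ z u) u v
  simp only [coreForm_J_left, imForm_self, imForm_J, zero_smul, sub_zero, coreForm_smul_left,
    coreForm_smul_right] at h2
  nlinarith

theorem coreForm_J_J (u : H) : coreForm z (coreJ z u) (coreJ z u) = coreForm z u u := by
  rw [coreForm_J_left, imForm_J]

theorem coreForm_self_self_le : coreForm z z z ≤ 1 := by
  have := weight_mul z
  rw [coreForm_self_left]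
  linarith [weight_pos z]

/-- The squared norm of `β` is `1 - weight z`. This bound makes the estimates uniform over the
noncompact base. -/
theorem coreForm_sharp_sharp_le : coreForm z (coreSharp z) (coreSharp z) ≤ 1 := by
  rw [coreForm_sharp, imForm_sharp, ← coreForm_self_left]
  exact coreForm_self_self_le z

theorem coreForm_sharp_sharp_nonneg : 0 ≤ imForm z (coreSharp z) := by
  rw [← coreForm_sharp]; exact coreForm_self_nonneg _ _

theorem imForm_base_sq_le (u : H) : imForm z u ^ 2 ≤ coreForm z u u := by
  have h := coreForm_cauchySchwarz z (coreSharp z) u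
  rw [coreForm_sharp] at h
  exact h.trans (mul_le_of_le_one_left (coreForm_self_nonneg z u) (coreForm_sharp_sharp_le z))

theorem reForm_base_sq_le (u : H) : (weight z * reForm z u) ^ 2 ≤ coreForm z u u := by
  have h := coreForm_cauchySchwarz z z u
  rw [coreForm_self_left z u] at h
  exact h.trans (mul_le_of_le_one_left (coreForm_self_nonneg z u) (coreForm_self_self_le z))

theorem coreTwist_sq_le (u v : H) :
    coreTwist z u v ^ 2 ≤ 4 * (coreForm z u u * coreForm z v v) := by
  have h1 := mul_le_mul (imForm_base_sq_le z v) (reForm_base_sq_le z u) (sq_nonneg _)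
    (coreForm_self_nonneg z v)
  have h2 := mul_le_mul (imForm_base_sq_le z u) (reForm_base_sq_le z v) (sq_nonneg _)
    (coreForm_self_nonneg z u)
  have h3 : coreTwist z u v = imForm z v * (weight z * reForm z u)
      + imForm z u * (weight z * reForm z v) := by
    simp only [coreTwist]; ring
  rw [h3]
  nlinarith [sq_nonneg (imForm z v * (weight z * reForm z u)
      - imForm z u * (weight z * reForm z v))]

theorem contract_base_sq_le (w u v : H) :
    (coreForm z w u * imForm z v - coreForm z w v * imForm z u) ^ 2
      ≤ coreForm z w w * (coreForm z u u * coreForm z v v - coreForm z u v ^ 2) := by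
  have h1 := coreForm_contract_le z (coreSharp z) u v
  simp only [coreForm_sharp z u, coreForm_sharp z v] at h1
  have h2 := coreForm_cauchySchwarz z w (imForm z v • u - imForm z u • v)
  have h3 : coreForm z w (imForm z v • u - imForm z u • v)
      = coreForm z w u * imForm z v - coreForm z w v * imForm z u := by
    simp only [coreForm_sub_right, coreForm_smul_right]; ring
  rw [h3] at h2
  have h4 := mul_le_of_le_one_left (coreForm_wedge_nonneg z u v) (coreForm_sharp_sharp_le z)
  exact h2.trans (mul_le_mul_of_nonneg_left (h1.trans h4) (coreForm_self_nonneg z w))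

theorem imForm_sq_le (u v : H) : imForm u v ^ 2 ≤ coreForm z u u * coreForm z v v := by
  linarith [imForm_sq_le_wedge z u v, sq_nonneg (coreForm z u v)]

end CoreInequalities

/-! ### Scalar estimates for the curvature form -/

section ScalarBounds

theorem abs_mul_le_half {p q P Q : ℝ} (hp : p ^ 2 ≤ P) (hq : q ^ 2 ≤ Q) :
    |p * q| ≤ (P + Q) / 2 := by
  rw [abs_mul]
  nlinarith [sq_nonneg (|p| - |q|), sq_abs p, sq_abs q]

theorem abs_le_half_add {p P Q : ℝ} (hP : 0 ≤ P) (hQ : 0 ≤ Q) (hp : p ^ 2 ≤ P * Q) :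
    |p| ≤ (P + Q) / 2 := by
  refine abs_le_of_sq_le_sq ?_ (by positivity)
  nlinarith [sq_nonneg (P - Q)]

theorem abs_mul_le_of_le {p q a b : ℝ} (hp : |p| ≤ a) (hq : |q| ≤ b) : |p * q| ≤ a * b := by
  rw [abs_mul]
  exact mul_le_mul hp hq (abs_nonneg _) ((abs_nonneg _).trans hp)

/-- The part of the curvature form that is small if `μ` and `ν` are. -/
theorem curvature_error_le {η S1 S2 S3 d Ω X Y Z T U n2 σ μ ν l L i : ℝ} (hη1 : η ≤ 1)
    (hS1 : 0 ≤ S1) (hS2 : 0 ≤ S2) (hS3 : 0 ≤ S3) (hΩ : Ω ^ 2 ≤ S1) (hX : X ^ 2 ≤ S2)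
    (hY : Y ^ 2 ≤ S3) (hZ : Z ^ 2 ≤ S3) (hT : T ^ 2 ≤ 4 * (S2 * S3)) (hU : U ^ 2 ≤ S3 * S1)
    (hn0 : 0 ≤ n2) (hn1 : n2 ≤ 1) (hσ0 : 0 ≤ σ) (hσ1 : σ ≤ 1) (hμ : |μ| ≤ η) (hν : |ν| ≤ η)
    (hl0 : 0 ≤ l) (hl3 : l ≤ 3) (hL0 : 0 ≤ L) (hL1 : L ≤ 1) (hi0 : 0 ≤ i) (hi1 : i ≤ 1) :
    |-(3 * (σ * μ) * (Ω * X)) - 3 / 4 * μ ^ 2 * X ^ 2 + σ * μ * (d * Z) + 1 / 4 * μ ^ 2 * n2 * d ^ 2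
      + 1 / 4 * μ ^ 2 * Y ^ 2 - 3 * (μ * i) * (d * Ω) + μ * i * T - ν * (d * X) - μ * L * U
      + L * μ * (d * X) - 3 * (l * μ) * (d * X)| ≤ 12 * η * (S1 + S2 + S3 + d ^ 2) := by
  have hη : 0 ≤ η := (abs_nonneg _).trans hμ
  have hd := sq_nonneg d
  set S := S1 + S2 + S3 + d ^ 2 with hS
  have hS0 : 0 ≤ S := by positivity
  have unit : ∀ c : ℝ, 0 ≤ c → c ≤ 1 → |c * μ| ≤ η := fun c h0 h1 => by
    rw [abs_mul, abs_of_nonneg h0]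
    nlinarith [abs_nonneg μ]
  have hμ2 : μ ^ 2 ≤ η := by
    rw [← sq_abs]; nlinarith [abs_nonneg μ]
  have hμ20 := sq_nonneg μ
  have b1 := abs_mul_le_of_le (unit σ hσ0 hσ1)
    ((abs_mul_le_half hΩ hX).trans (by linarith : _ ≤ S / 2))
  have b3 := abs_mul_le_of_le (unit σ hσ0 hσ1)
    ((abs_mul_le_half (le_refl (d ^ 2)) hZ).trans (by linarith : _ ≤ S / 2))
  have b6 := abs_mul_le_of_le (unit i hi0 hi1)
    ((abs_mul_le_half (le_refl (d ^ 2)) hΩ).trans (by linarith : _ ≤ S / 2))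
  have b7 := abs_mul_le_of_le (unit i hi0 hi1) (show |T| ≤ S by
    have := abs_le_half_add (p := T) (P := 2 * S2) (Q := 2 * S3) (by positivity) (by positivity)
      (by linarith)
    linarith)
  have hdX := (abs_mul_le_half (le_refl (d ^ 2)) hX).trans (by linarith : _ ≤ S / 2)
  have b8 := abs_mul_le_of_le hν hdX
  have b9 := abs_mul_le_of_le (unit L hL0 hL1) ((abs_le_half_add hS3 hS1 hU).trans
    (by linarith : _ ≤ S / 2))
  have b10 := abs_mul_le_of_le (unit L hL0 hL1) hdX
  have b11 := abs_mul_le_of_le (show |l * μ| ≤ 3 * η by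
    rw [abs_mul, abs_of_nonneg hl0]; nlinarith [abs_nonneg μ]) hdX
  have b2 : μ ^ 2 * X ^ 2 ≤ η * S := mul_le_mul hμ2 (by linarith) (sq_nonneg _) hη
  have b4 : μ ^ 2 * (n2 * d ^ 2) ≤ η * S :=
    mul_le_mul hμ2 ((mul_le_of_le_one_left hd hn1).trans (by linarith)) (by positivity) hη
  have b5 : μ ^ 2 * Y ^ 2 ≤ η * S := mul_le_mul hμ2 (by linarith) (sq_nonneg _) hη
  have b20 : 0 ≤ μ ^ 2 * X ^ 2 := by positivity
  have b40 : 0 ≤ μ ^ 2 * (n2 * d ^ 2) := by positivity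
  have b50 : 0 ≤ μ ^ 2 * Y ^ 2 := by positivity
  have hηS : 0 ≤ η * S := by positivity
  -- Weighted by their coefficients, the eleven bounds add up to less than `12 η S`.
  rw [abs_le] at b1 b3 b6 b7 b8 b9 b10 b11 ⊢
  constructor <;> linarith [b1.1, b1.2, b3.1, b3.2, b6.1, b6.2, b7.1, b7.2, b8.1, b8.2, b9.1, b9.2,
    b10.1, b10.2, b11.1, b11.2]

/-- The curvature conditions on the warping profile at one radius: either the fibration is nearly
flat (`σ` small), or the metric is nearly the complex hyperbolic one up to the value of `σ`. -/
structure ProfileBounds (η σ μ ν l k L i : ℝ) : Prop where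
  sigma_nonneg : 0 ≤ σ
  sigma_le : σ ≤ 1
  mu_le : |μ| ≤ η
  nu_le : |ν| ≤ η
  le_l : 1 - η ≤ l
  l_le : l ≤ 2 + η
  k_le : |k - l ^ 2| ≤ η
  le_L : 1 - η ≤ L
  L_le : L ≤ 1
  i_nonneg : 0 ≤ i
  i_le : i ^ 2 ≤ η
  dichotomy : σ ≤ η ∨ |l - 2| ≤ η

-- `S1`, `S2`, `S3`, `d²` are the squared norms of the orthogonal components of `u ∧ v`, so their
-- sum is the Gram determinant. At `η = 0` all coefficients lie in `[1, 4]` when `σ = 0`. When `l =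
-- 2` the cross term `6σΩd` needs care, and `hΩd` is what keeps the upper bound at `4`.
set_option maxHeartbeats 1000000 in
theorem curvature_main_bounds {η S1 S2 S3 d Ω σ μ ν l k L i : ℝ} (hη1 : η ≤ 1)
    (hS1 : 0 ≤ S1) (hS2 : 0 ≤ S2) (hS3 : 0 ≤ S3) (hΩ : Ω ^ 2 ≤ S1)
    (hΩd : (Ω * d) ^ 2 ≤ S2 * S3) (h : ProfileBounds η σ μ ν l k L i) :
    (1 - 18 * η) * (S1 + S2 + S3 + d ^ 2) ≤ S1 + S2 + (l * L - σ ^ 2) * S3 + k * d ^ 2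
        + 3 * (σ ^ 2 + i ^ 2) * Ω ^ 2 + 6 * (σ * (l - L)) * (Ω * d) ∧
      S1 + S2 + (l * L - σ ^ 2) * S3 + k * d ^ 2
        + 3 * (σ ^ 2 + i ^ 2) * Ω ^ 2 + 6 * (σ * (l - L)) * (Ω * d)
        ≤ (4 + 18 * η) * (S1 + S2 + S3 + d ^ 2) := by
  obtain ⟨hσ0, hσ1, hμ, -, hl, hl', hk, hL, hL', hi0, hi, hcase⟩ := h
  have hη : 0 ≤ η := (abs_nonneg _).trans hμ
  have hd := sq_nonneg d
  set S := S1 + S2 + S3 + d ^ 2 with hS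
  have hS0 : 0 ≤ S := by positivity
  have hη2 : η ^ 2 ≤ η := by nlinarith
  have hηS1 : 0 ≤ η * S1 := by positivity
  have hηS2 : 0 ≤ η * S2 := by positivity
  have hηS3 : 0 ≤ η * S3 := by positivity
  have hηd : 0 ≤ η * d ^ 2 := by positivity
  have hηS : η * S = η * S1 + η * S2 + η * S3 + η * d ^ 2 := by rw [hS]; ring
  have hΩd' : |Ω * d| ≤ S / 2 := by
    have := abs_mul_le_half hΩ (le_refl (d ^ 2))
    linarith
  have hΩ0 := sq_nonneg Ω
  have hi1 : i ^ 2 * Ω ^ 2 ≤ η * S1 := mul_le_mul hi hΩ hΩ0 hη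
  have hi2 : 0 ≤ i ^ 2 * Ω ^ 2 := by positivity
  rw [abs_le] at hk
  rcases hcase with hσ | hl2
  -- Small `σ`: the cross term is an error, and `l * L` and `k ≈ l²` lie in `[1, 4]` up to `O(η)`.
  · have hσ2 : σ ^ 2 ≤ η := by nlinarith
    have hσ20 := sq_nonneg σ
    have c1 : |σ * (l - L) * (Ω * d)| ≤ 3 / 2 * (η * S) := by
      have h1 : |σ * (l - L)| ≤ η * 3 := by
        refine abs_mul_le_of_le (by rwa [abs_of_nonneg hσ0]) ?_
        rw [abs_le]; constructor <;> linarith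
      have := abs_mul_le_of_le h1 hΩd'
      linarith
    have c2 : 1 - 2 * η ≤ l * L := by nlinarith
    have c3 : l * L ≤ 3 := by nlinarith
    have c4 : 1 - 3 * η ≤ k := by nlinarith [hk.1]
    have c5 : k ≤ 4 + 6 * η := by nlinarith [hk.2]
    have c6 : σ ^ 2 * Ω ^ 2 ≤ η * S1 := mul_le_mul hσ2 hΩ hΩ0 hη
    have c60 : 0 ≤ σ ^ 2 * Ω ^ 2 := by positivity
    have c7 := mul_le_mul_of_nonneg_right c2 hS3
    have c8 := mul_le_mul_of_nonneg_right c3 hS3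
    have c9 := mul_le_mul_of_nonneg_right c4 hd
    have c10 := mul_le_mul_of_nonneg_right c5 hd
    have c11 := mul_le_mul_of_nonneg_right hσ2 hS3
    have c12 := mul_nonneg hσ20 hS3
    rw [abs_le] at c1
    constructor <;> linarith [c1.1, c1.2]
  · rw [abs_le] at hl2
    have hσ2 : σ ^ 2 ≤ 1 := by nlinarith
    have hσ20 := sq_nonneg σ
    have c1 : |σ * (l - L - 1) * (Ω * d)| ≤ η * S := by
      have h1 : |σ * (l - L - 1)| ≤ 1 * (2 * η) := by
        refine abs_mul_le_of_le (by rwa [abs_of_nonneg hσ0]) ?_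
        rw [abs_le]; constructor <;> linarith [hl2.1, hl2.2]
      have := abs_mul_le_of_le h1 hΩd'
      linarith
    have c2 : 2 - 3 * η ≤ l * L := by nlinarith [hl2.1, hl2.2]
    have c3 : l * L ≤ 2 + η := by nlinarith [hl2.1, hl2.2]
    have c4 : 4 - 6 * η ≤ k := by nlinarith [hk.1, hl2.1, hl2.2]
    have c5 : k ≤ 4 + 6 * η := by nlinarith [hk.2, hl2.1, hl2.2]
    have c7 := mul_le_mul_of_nonneg_right c2 hS3
    have c8 := mul_le_mul_of_nonneg_right c3 hS3
    have c9 := mul_le_mul_of_nonneg_right c4 hd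
    have c10 := mul_le_mul_of_nonneg_right c5 hd
    have c11 := mul_nonneg hσ20 hS3
    have c12 := mul_le_mul_of_nonneg_right hσ2 hS3
    -- Upper bound for `l ≈ 2`: `6σΩd ≤ 3 S2 + 3σ² S3` brings the coefficient of `S2` to `4` and
    -- that of `S3` to `2 + 2σ² ≤ 4`, while `S1 + 3σ²Ω² ≤ 4 S1`.
    have c13 : |σ * (Ω * d)| ≤ (S2 + σ ^ 2 * S3) / 2 := by
      refine abs_le_half_add hS2 c11 ?_
      nlinarith [mul_le_mul_of_nonneg_left hΩd hσ20]
    have c14 : σ ^ 2 * Ω ^ 2 ≤ S1 :=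
      (mul_le_of_le_one_left hΩ0 hσ2).trans hΩ
    -- Lower bound for `l ≈ 2`: three of the four `d²` complete the square `3(σΩ + d)²`, and `2 - σ²
    -- ≥ 1`.
    have c15 := sq_nonneg (σ * Ω + d)
    rw [abs_le] at c1 c13
    constructor <;> linarith [c1.1, c1.2, c13.1, c13.2]

end ScalarBounds

/-! ### Curvature bounds for the warped metric -/

section WarpedBounds

variable {H : Type*} [NormedAddCommGroup H] [InnerProductSpace ℂ H]

/-- The horizontal, radial and angular directions are orthogonal, so `|u ∧ v|²` is a sum over the
components of the bivector. -/
theorem warpForm_gram (B φ : ℝ → ℝ) (p u v : H × ℝ × ℝ) :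
    warpForm B φ p u u * warpForm B φ p v v - warpForm B φ p u v ^ 2
      = Real.cosh p.2.2 ^ 4 * (coreForm p.1 u.1 u.1 * coreForm p.1 v.1 v.1
          - coreForm p.1 u.1 v.1 ^ 2)
        + Real.cosh p.2.2 ^ 2 * coreForm p.1 (u.2.2 • v.1 - v.2.2 • u.1) (u.2.2 • v.1 - v.2.2 • u.1)
        + Real.cosh p.2.2 ^ 2 * B p.2.2 ^ 2
          * coreForm p.1 (angular φ p v • u.1 - angular φ p u • v.1)
            (angular φ p v • u.1 - angular φ p u • v.1)
        + (B p.2.2 * (angular φ p v * u.2.2 - angular φ p u * v.2.2)) ^ 2 := by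
  simp only [warpForm, coreForm_sub_left, coreForm_sub_right, coreForm_smul_left,
    coreForm_smul_right, coreForm_comm p.1 v.1 u.1]
  ring

/-- The constant is `30 = 18 + 12`, from `curvature_main_bounds` and `curvature_error_le`. -/
theorem warpForm_curvature_bounds {η : ℝ} (hη1 : η ≤ 1) (B φ : ℝ → ℝ) (p u v : H × ℝ × ℝ)
    (hB : 0 < B p.2.2)
    (h : ProfileBounds η (B p.2.2 * φ p.2.2 / Real.cosh p.2.2 ^ 2)
      (B p.2.2 * deriv φ p.2.2 / Real.cosh p.2.2) (B p.2.2 * deriv (deriv φ) p.2.2 / Real.cosh p.2.2)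
      (deriv B p.2.2 / B p.2.2) (deriv (deriv B) p.2.2 / B p.2.2)
      (Real.sinh p.2.2 / Real.cosh p.2.2) (1 / Real.cosh p.2.2)) {N S : ℝ}
    (hS : S = warpForm B φ p u u * warpForm B φ p v v - warpForm B φ p u v ^ 2)
    (hN : N = warpForm2 B φ p u v v u - 1 / 2 * warpForm2 B φ p u u v v
      - 1 / 2 * warpForm2 B φ p v v u u
      + warpForm B φ p (warpChristoffel B φ p u v) (warpChristoffel B φ p u v)
      - warpForm B φ p (warpChristoffel B φ p u u) (warpChristoffel B φ p v v)) :
    -((4 + 30 * η) * S) ≤ N ∧ N ≤ -((1 - 30 * η) * S) := by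
  have hN' := warpForm_curvature B φ p u v hB.ne' rfl rfl rfl rfl rfl rfl rfl rfl rfl rfl rfl rfl rfl
  rw [← hN] at hN'
  rw [warpForm_gram] at hS
  set z := p.1
  set x := u.1
  set y := v.1
  set w := angular φ p v • x - angular φ p u • y with hw
  set s := u.2.2 • y - v.2.2 • x with hs
  set δ := angular φ p v * u.2.2 - angular φ p u * v.2.2 with hδ
  have hA := Real.cosh_pos p.2.2
  have hA1 := Real.one_le_cosh p.2.2
  have hAS := Real.cosh_sq p.2.2
  have f1 := imForm_sq_le_wedge z x y
  have f2 := imForm_base_sq_le z s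
  have f3 := imForm_base_sq_le z w
  have f4 := imForm_base_sq_le z (coreJ z w)
  rw [coreForm_J_J] at f4
  have f5 := coreTwist_sq_le z w s
  have f6 := contract_base_sq_le z w x y
  have f7 := imForm_sq_le z s w
  have f8 := coreForm_sharp_sharp_nonneg z
  have f9 := coreForm_sharp_sharp_le z
  rw [coreForm_sharp] at f9
  -- A Plücker-type relation: `s` and `w` both lie in the span of `x` and `y`. With `imForm_sq_le`
  -- it bounds `(Ωd)²` by `S2 * S3`.
  have f10 : imForm s w = -(δ * imForm x y) := by
    rw [hs, hw, hδ]
    simp only [map_sub, map_smul, sub_apply, smul_apply, smul_eq_mul, imForm_self, imForm_comm y x]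
    ring
  rw [f10] at f7
  have g1 := coreForm_wedge_nonneg z x y
  have g2 := coreForm_self_nonneg z s
  have g3 := coreForm_self_nonneg z w
  generalize coreForm z x x * coreForm z y y - coreForm z x y ^ 2 = W at *
  generalize coreForm z s s = P at *
  generalize coreForm z w w = Q at *
  generalize imForm x y = om at *
  generalize imForm z s = X at *
  generalize imForm z w = Y at *
  generalize imForm z (coreJ z w) = Z at *
  generalize coreTwist z w s = T at *
  generalize coreForm z w x * imForm z y - coreForm z w y * imForm z x = U at *
  generalize imForm z (coreSharp z) = n2 at *
  generalize hAe : Real.cosh p.2.2 = A at *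
  generalize hSe : Real.sinh p.2.2 = Sh at *
  generalize B p.2.2 = b at *
  generalize deriv B p.2.2 = b1 at *
  generalize deriv (deriv B) p.2.2 = b2 at *
  generalize φ p.2.2 = f at *
  generalize deriv φ p.2.2 = f1' at *
  generalize deriv (deriv φ) p.2.2 = f2' at *
  have k1 : 0 ≤ A ^ 4 * W := by positivity
  have k2 : 0 ≤ A ^ 2 * P := by positivity
  have k3 : 0 ≤ A ^ 2 * b ^ 2 * Q := by positivity
  have k4 : (A ^ 2 * om) ^ 2 ≤ A ^ 4 * W := by
    calc (A ^ 2 * om) ^ 2 = A ^ 4 * om ^ 2 := by ring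
      _ ≤ _ := by gcongr
  have k5 : (A * X) ^ 2 ≤ A ^ 2 * P := by rw [mul_pow]; gcongr
  have k6 : (A * b * Y) ^ 2 ≤ A ^ 2 * b ^ 2 * Q := by rw [mul_pow, mul_pow]; gcongr
  have k7 : (A * b * Z) ^ 2 ≤ A ^ 2 * b ^ 2 * Q := by rw [mul_pow, mul_pow]; gcongr
  have k8 : (A ^ 2 * b * T) ^ 2 ≤ 4 * (A ^ 2 * P * (A ^ 2 * b ^ 2 * Q)) := by
    calc (A ^ 2 * b * T) ^ 2 = (A ^ 2 * b) ^ 2 * T ^ 2 := by ring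
      _ ≤ (A ^ 2 * b) ^ 2 * (4 * (Q * P)) := by gcongr
      _ = _ := by ring
  have k9 : (A ^ 3 * b * U) ^ 2 ≤ A ^ 2 * b ^ 2 * Q * (A ^ 4 * W) := by
    calc (A ^ 3 * b * U) ^ 2 = (A ^ 3 * b) ^ 2 * U ^ 2 := by ring
      _ ≤ (A ^ 3 * b) ^ 2 * (Q * W) := by gcongr
      _ = _ := by ring
  have k10 : (A ^ 2 * om * (b * δ)) ^ 2 ≤ A ^ 2 * P * (A ^ 2 * b ^ 2 * Q) := by
    calc (A ^ 2 * om * (b * δ)) ^ 2 = (A ^ 2 * b) ^ 2 * (-(δ * om)) ^ 2 := by ring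
      _ ≤ (A ^ 2 * b) ^ 2 * (P * Q) := by gcongr
      _ = _ := by ring
  have hi1 : 1 / A ≤ 1 := by rw [div_le_one hA]; exact hA1
  have hη : 0 ≤ η := (abs_nonneg _).trans h.mu_le
  have hl0 : 0 ≤ b1 / b := by linarith [h.le_l]
  have hL0 : 0 ≤ Sh / A := by linarith [h.le_L]
  have hmain := curvature_main_bounds hη1 k1 k2 k3 k4 k10 h
  have herr := curvature_error_le (d := b * δ) hη1 k1 k2 k3 k4 k5 k6 k7 k8 k9 f8 f9 h.sigma_nonneg
    h.sigma_le h.mu_le h.nu_le hl0 (by linarith [h.l_le]) hL0 h.L_le h.i_nonneg hi1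
  rw [← hS] at hmain herr
  rw [abs_le] at herr
  -- The first bracket has no derivative of `φ`; every term of the second contains `μ` or `ν`.
  have key : N = -(A ^ 4 * W + A ^ 2 * P + (b1 / b * (Sh / A) - (b * f / A ^ 2) ^ 2)
        * (A ^ 2 * b ^ 2 * Q) + b2 / b * (b * δ) ^ 2
        + 3 * ((b * f / A ^ 2) ^ 2 + (1 / A) ^ 2) * (A ^ 2 * om) ^ 2
        + 6 * (b * f / A ^ 2 * (b1 / b - Sh / A)) * (A ^ 2 * om * (b * δ)))
      + (-(3 * (b * f / A ^ 2 * (b * f1' / A)) * (A ^ 2 * om * (A * X)))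
        - 3 / 4 * (b * f1' / A) ^ 2 * (A * X) ^ 2
        + b * f / A ^ 2 * (b * f1' / A) * (b * δ * (A * b * Z))
        + 1 / 4 * (b * f1' / A) ^ 2 * n2 * (b * δ) ^ 2
        + 1 / 4 * (b * f1' / A) ^ 2 * (A * b * Y) ^ 2
        - 3 * (b * f1' / A * (1 / A)) * (b * δ * (A ^ 2 * om))
        + b * f1' / A * (1 / A) * (A ^ 2 * b * T) - b * f2' / A * (b * δ * (A * X))
        - b * f1' / A * (Sh / A) * (A ^ 3 * b * U) + Sh / A * (b * f1' / A) * (b * δ * (A * X))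
        - 3 * (b1 / b * (b * f1' / A)) * (b * δ * (A * X))) := by
    have hA4 : A ^ 4 * W = A ^ 2 * W + (A * Sh) ^ 2 * W := by
      linear_combination (A ^ 2 * W) * hAS
    rw [hN', hA4]
    field_simp
    ring
  constructor <;> linarith [herr.1, herr.2, hmain.1, hmain.2]

end WarpedBounds

/-! ### Derivatives of the warped metric along lines -/

section WarpedDerivatives

variable {H : Type*} [NormedAddCommGroup H] [InnerProductSpace ℂ H]

theorem hasDerivAt_form_line (F : H →L[ℝ] H →L[ℝ] ℝ) (z d u : H) :
    HasDerivAt (fun s : ℝ => F (z + s • d) u) (F d u) 0 := by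
  have h : (fun s : ℝ => F (z + s • d) u) = fun s : ℝ => F z u + s * F d u := by
    ext s; simp
  rw [h]
  simpa using ((hasDerivAt_id (0 : ℝ)).mul_const (F d u)).const_add (F z u)

theorem hasDerivAt_weight_line (z d : H) :
    HasDerivAt (fun s : ℝ => weight (z + s • d)) (-(2 * weight z ^ 2 * reForm z d)) 0 := by
  have h : (fun s : ℝ => weight (z + s • d)) = fun s : ℝ =>
      (1 + (reForm z z + 2 * s * reForm z d + s ^ 2 * reForm d d))⁻¹ := by
    ext s
    rw [weight, ← reForm_self]
    simp only [map_add, map_smul, add_apply, smul_apply, smul_eq_mul, reForm_comm d z]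
    ring
  have hw : (1 + reForm z z) = (weight z)⁻¹ := by
    rw [weight, inv_inv, reForm_self]
  have hk := (weight_pos z).ne'
  rw [h]
  have h1 : HasDerivAt (fun s : ℝ => 1 + (reForm z z + 2 * s * reForm z d + s ^ 2 * reForm d d))
      (2 * reForm z d) 0 := by
    have h2 := ((((hasDerivAt_id (0 : ℝ)).const_mul 2).mul_const (reForm z d)).const_add
      (reForm z z)).add (((hasDerivAt_id (0 : ℝ)).pow 2).mul_const (reForm d d))
    have h3 := h2.const_add 1
    simpa using h3
  refine (h1.fun_inv (by simp [hw, hk])).congr_deriv ?_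
  simp only [mul_zero, zero_mul, add_zero, ne_eq, OfNat.ofNat_ne_zero, not_false_eq_true, zero_pow,
    hw]
  field_simp

theorem hasDerivAt_coreForm_line (z d u v : H) :
    HasDerivAt (fun s : ℝ => coreForm (z + s • d) u v) (coreForm1 z d u v) 0 := by
  have hu := hasDerivAt_form_line reForm z d u
  have hv := hasDerivAt_form_line reForm z d v
  have hu' := hasDerivAt_form_line imForm z d u
  have hv' := hasDerivAt_form_line imForm z d v
  have hk := hasDerivAt_weight_line z d
  refine (((hk.mul (hu.mul hv)).const_sub (reForm u v)).add (hu'.mul hv')).congr_deriv ?_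
  simp only [Pi.mul_apply, Pi.add_apply, Pi.neg_apply, Pi.pow_apply,
    zero_smul, add_zero, coreForm1]
  ring

theorem hasDerivAt_coreForm1_line (z d e u v : H) :
    HasDerivAt (fun s : ℝ => coreForm1 (z + s • d) e u v) (coreForm2 z d e u v) 0 := by
  have hu := hasDerivAt_form_line reForm z d u
  have hv := hasDerivAt_form_line reForm z d v
  have he := hasDerivAt_form_line reForm z d e
  have hu' := hasDerivAt_form_line imForm z d u
  have hv' := hasDerivAt_form_line imForm z d v
  have hk := hasDerivAt_weight_line z d
  refine ((((hk.neg.mul ((hv.const_mul (reForm e u)).add (hu.mul_const (reForm e v)))).add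
    ((((hk.pow 2).const_mul 2).mul he |>.mul hu).mul hv)).add (hv'.const_mul (imForm e u))).add
    (hu'.mul_const (imForm e v))).congr_deriv ?_
  simp only [Pi.mul_apply, Pi.add_apply, Pi.neg_apply, Pi.pow_apply,
    zero_smul, add_zero, coreForm2, Nat.cast_ofNat]
  ring

theorem hasDerivAt_comp_line {f : ℝ → ℝ} {f' : ℝ} (r b : ℝ) (hf : HasDerivAt f f' r) :
    HasDerivAt (fun s : ℝ => f (r + s * b)) (f' * b) 0 := by
  have h1 : HasDerivAt (fun s : ℝ => r + s * b) b 0 := by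
    simpa using ((hasDerivAt_id (0 : ℝ)).mul_const b).const_add r
  have h2 : HasDerivAt f f' (r + 0 * b) := by simpa using hf
  exact h2.comp (0 : ℝ) h1

variable {B φ : ℝ → ℝ}

theorem hasDerivAt_angular_line (hφ : ContDiff ℝ ∞ φ) (p d u : H × ℝ × ℝ) :
    HasDerivAt (fun s : ℝ => angular φ (p + s • d) u) (angular1 φ p d u) 0 := by
  have h1 := hasDerivAt_comp_line p.2.2 d.2.2 ((hφ.differentiable (by simp)) p.2.2).hasDerivAt
  have h2 := hasDerivAt_form_line imForm p.1 d.1 u.1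
  refine ((h1.mul h2).const_add u.2.1).congr_deriv ?_
  simp only [Pi.mul_apply, Pi.add_apply, Pi.neg_apply, Pi.pow_apply,
    zero_smul, add_zero, zero_mul, angular1]

theorem hasDerivAt_angular1_line (hφ : ContDiff ℝ ∞ φ) (p d e u : H × ℝ × ℝ) :
    HasDerivAt (fun s : ℝ => angular1 φ (p + s • d) e u) (angular2 φ p d e u) 0 := by
  have hφ' : ContDiff ℝ ∞ (deriv φ) := hφ.iterate_deriv 1
  have h1 := hasDerivAt_comp_line p.2.2 d.2.2 ((hφ.differentiable (by simp)) p.2.2).hasDerivAt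
  have h1' := hasDerivAt_comp_line p.2.2 d.2.2 ((hφ'.differentiable (by simp)) p.2.2).hasDerivAt
  have h2 := hasDerivAt_form_line imForm p.1 d.1 u.1
  refine (((h1'.mul_const e.2.2).mul h2).add (h1.mul_const (imForm e.1 u.1))).congr_deriv ?_
  simp only [Pi.mul_apply, Pi.add_apply, Pi.neg_apply, Pi.pow_apply,
    zero_smul, add_zero, zero_mul, angular2]

theorem hasDerivAt_warpForm_line (hB : ContDiff ℝ ∞ B) (hφ : ContDiff ℝ ∞ φ)
    (p d u v : H × ℝ × ℝ) :
    HasDerivAt (fun s : ℝ => warpForm B φ (p + s • d) u v) (warpForm1 B φ p d u v) 0 := by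
  have hc := hasDerivAt_comp_line p.2.2 d.2.2 (Real.hasDerivAt_cosh p.2.2)
  have hb := hasDerivAt_comp_line p.2.2 d.2.2 ((hB.differentiable (by simp)) p.2.2).hasDerivAt
  have h1 := hasDerivAt_coreForm_line p.1 d.1 u.1 v.1
  have h2 := hasDerivAt_angular_line hφ p d u
  have h3 := hasDerivAt_angular_line hφ p d v
  refine ((((hc.pow 2).mul h1).add ((hb.pow 2).mul (h2.mul h3))).add_const
    (u.2.2 * v.2.2)).congr_deriv ?_
  simp only [Pi.mul_apply, Pi.add_apply, Pi.neg_apply, Pi.pow_apply,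
    zero_smul, add_zero, zero_mul, warpForm1, Nat.cast_ofNat]
  ring

theorem hasDerivAt_warpForm1_line (hB : ContDiff ℝ ∞ B) (hφ : ContDiff ℝ ∞ φ)
    (p d e u v : H × ℝ × ℝ) :
    HasDerivAt (fun s : ℝ => warpForm1 B φ (p + s • d) e u v) (warpForm2 B φ p d e u v) 0 := by
  have hB' : ContDiff ℝ ∞ (deriv B) := hB.iterate_deriv 1
  have hc := hasDerivAt_comp_line p.2.2 d.2.2 (Real.hasDerivAt_cosh p.2.2)
  have hs := hasDerivAt_comp_line p.2.2 d.2.2 (Real.hasDerivAt_sinh p.2.2)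
  have hb := hasDerivAt_comp_line p.2.2 d.2.2 ((hB.differentiable (by simp)) p.2.2).hasDerivAt
  have hb' := hasDerivAt_comp_line p.2.2 d.2.2 ((hB'.differentiable (by simp)) p.2.2).hasDerivAt
  have h1 := hasDerivAt_coreForm_line p.1 d.1 u.1 v.1
  have h1' := hasDerivAt_coreForm1_line p.1 d.1 e.1 u.1 v.1
  have h2 := hasDerivAt_angular_line hφ p d u
  have h3 := hasDerivAt_angular_line hφ p d v
  have h2' := hasDerivAt_angular1_line hφ p d e u
  have h3' := hasDerivAt_angular1_line hφ p d e v
  refine (((((((hc.const_mul 2).mul hs).mul_const e.2.2).mul h1).add ((hc.pow 2).mul h1')).add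
    ((((hb.const_mul 2).mul hb').mul_const e.2.2).mul (h2.mul h3))).add
    ((hb.pow 2).mul ((h2'.mul h3).add (h2.mul h3')))).congr_deriv ?_
  simp only [Pi.mul_apply, Pi.add_apply, Pi.neg_apply, Pi.pow_apply,
    zero_smul, add_zero, zero_mul, warpForm2, Nat.cast_ofNat]
  ring

end WarpedDerivatives

/-! ### The warped metric as a smooth positive definite field -/

section WarpedMetric

variable {H : Type*} [NormedAddCommGroup H] [InnerProductSpace ℂ H]

/-- `warpForm B φ p` as a continuous bilinear form. -/
def warpMetric (B φ : ℝ → ℝ) (p : H × ℝ × ℝ) : H × ℝ × ℝ →L[ℝ] H × ℝ × ℝ →L[ℝ] ℝ :=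
  let base : H × ℝ × ℝ →L[ℝ] H := ContinuousLinearMap.fst ℝ H (ℝ × ℝ)
  let dr : H × ℝ × ℝ →L[ℝ] ℝ :=
    (ContinuousLinearMap.snd ℝ ℝ ℝ).comp (ContinuousLinearMap.snd ℝ H (ℝ × ℝ))
  let dθ : H × ℝ × ℝ →L[ℝ] ℝ :=
    (ContinuousLinearMap.fst ℝ ℝ ℝ).comp (ContinuousLinearMap.snd ℝ H (ℝ × ℝ))
  let α : H × ℝ × ℝ →L[ℝ] ℝ := (reForm p.1).comp base
  let β : H × ℝ × ℝ →L[ℝ] ℝ := (imForm p.1).comp base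
  let η : H × ℝ × ℝ →L[ℝ] ℝ := dθ + φ p.2.2 • β
  Real.cosh p.2.2 ^ 2 • (reForm.bilinearComp base base - weight p.1 • α.smulRight α + β.smulRight β)
    + B p.2.2 ^ 2 • η.smulRight η + dr.smulRight dr

theorem warpMetric_apply (B φ : ℝ → ℝ) (p u v : H × ℝ × ℝ) :
    warpMetric B φ p u v = warpForm B φ p u v := by
  simp [warpMetric, warpForm, coreForm, angular]
  ring

theorem warpForm_comm (B φ : ℝ → ℝ) (p u v : H × ℝ × ℝ) :
    warpForm B φ p u v = warpForm B φ p v u := by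
  simp only [warpForm, coreForm_comm p.1 u.1]; ring

theorem warpForm_self_pos (B φ : ℝ → ℝ) {p u : H × ℝ × ℝ} (hB : 0 < B p.2.2) (hu : u ≠ 0) :
    0 < warpForm B φ p u u := by
  have hc := Real.cosh_pos p.2.2
  have h1 := coreForm_self_nonneg p.1 u.1
  rw [warpForm]
  by_cases hx : u.1 = 0
  · by_cases hr : u.2.2 = 0
    · have ht : u.2.1 ≠ 0 := fun ht => hu (Prod.ext hx (Prod.ext ht hr))
      have ha : angular φ p u ≠ 0 := by simpa [angular, hx] using ht
      have : 0 < angular φ p u * angular φ p u := mul_self_pos.2 ha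
      have := mul_pos (pow_pos hB 2) this
      have := mul_nonneg (sq_nonneg (Real.cosh p.2.2)) h1
      linarith [mul_self_nonneg u.2.2]
    · have := mul_self_pos.2 hr
      have := mul_nonneg (sq_nonneg (Real.cosh p.2.2)) h1
      have := mul_nonneg (sq_nonneg (B p.2.2)) (mul_self_nonneg (angular φ p u))
      linarith
  · have := mul_pos (pow_pos hc 2) (coreForm_self_pos p.1 hx)
    have := mul_nonneg (sq_nonneg (B p.2.2)) (mul_self_nonneg (angular φ p u))
    linarith [mul_self_nonneg u.2.2]

theorem contDiff_weight : ContDiff ℝ ∞ (weight : H → ℝ) := by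
  have h : (weight : H → ℝ) = fun z => (1 + reForm z z)⁻¹ := by
    ext z; rw [weight, reForm_self]
  rw [h]
  refine ContDiff.inv (by fun_prop) fun z => ?_
  rw [reForm_self]; positivity

theorem contDiff_warpMetric [FiniteDimensional ℝ H] {B φ : ℝ → ℝ} (hB : ContDiff ℝ ∞ B)
    (hφ : ContDiff ℝ ∞ φ) : ContDiff ℝ ∞ (warpMetric B φ : H × ℝ × ℝ → _) := by
  refine contDiff_clm_apply_iff.2 fun u => contDiff_clm_apply_iff.2 fun v => ?_
  simp only [warpMetric_apply, warpForm, coreForm, angular]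
  have h1 : ContDiff ℝ ∞ fun p : H × ℝ × ℝ => weight p.1 := contDiff_weight.comp contDiff_fst
  have h2 : ContDiff ℝ ∞ fun p : H × ℝ × ℝ => Real.cosh p.2.2 :=
    Real.contDiff_cosh.comp (contDiff_snd.comp contDiff_snd)
  have h3 : ContDiff ℝ ∞ fun p : H × ℝ × ℝ => B p.2.2 := hB.comp (contDiff_snd.comp contDiff_snd)
  have h4 : ContDiff ℝ ∞ fun p : H × ℝ × ℝ => φ p.2.2 := hφ.comp (contDiff_snd.comp contDiff_snd)
  fun_prop

theorem warpForm_gram_pos (B φ : ℝ → ℝ) {p u v : H × ℝ × ℝ} (hB : 0 < B p.2.2)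
    (h : LinearIndependent ℝ ![u, v]) :
    0 < warpForm B φ p u u * warpForm B φ p v v - warpForm B φ p u v ^ 2 := by
  have hu : u ≠ 0 := by simpa using h.ne_zero 0
  have hpos := warpForm_self_pos B φ hB hu
  have hne : warpForm B φ p u u • v - warpForm B φ p u v • u ≠ 0 := by
    intro h0
    have h1 := (LinearIndependent.pair_iff.1 h) (-warpForm B φ p u v) (warpForm B φ p u u) (by
      rw [neg_smul, ← h0]; abel)
    exact hpos.ne' h1.2
  have h2 := warpForm_self_pos B φ hB hne
  have h3 : warpForm B φ p (warpForm B φ p u u • v - warpForm B φ p u v • u)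
      (warpForm B φ p u u • v - warpForm B φ p u v • u)
      = warpForm B φ p u u * (warpForm B φ p u u * warpForm B φ p v v - warpForm B φ p u v ^ 2) := by
    rw [← warpMetric_apply B φ p (warpForm B φ p u u • v - warpForm B φ p u v • u)]
    simp only [map_sub, map_smul, sub_apply, smul_apply, smul_eq_mul, warpMetric_apply,
      warpForm_comm B φ p v u]
    ring
  rw [h3] at h2
  exact pos_of_mul_pos_right h2 hpos.le

theorem sectionalCurvature_warpMetric [FiniteDimensional ℝ H] {S : Set (H × ℝ × ℝ)}
    (hS : UniqueDiffOn ℝ S) {B φ : ℝ → ℝ} (hB : ContDiff ℝ ∞ B) (hφ : ContDiff ℝ ∞ φ)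
    {p : H × ℝ × ℝ} (hp : p ∈ S) (hBp : 0 < B p.2.2) {η : ℝ} (hη1 : η ≤ 1)
    (h : ProfileBounds η (B p.2.2 * φ p.2.2 / Real.cosh p.2.2 ^ 2)
      (B p.2.2 * deriv φ p.2.2 / Real.cosh p.2.2) (B p.2.2 * deriv (deriv φ) p.2.2 / Real.cosh p.2.2)
      (deriv B p.2.2 / B p.2.2) (deriv (deriv B) p.2.2 / B p.2.2)
      (Real.sinh p.2.2 / Real.cosh p.2.2) (1 / Real.cosh p.2.2))
    {u v : H × ℝ × ℝ} (huv : LinearIndependent ℝ ![u, v]) :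
    sectionalCurvature S (warpMetric B φ) p u v ∈ Set.Icc (-(4 + 30 * η)) (-(1 - 30 * η)) := by
  have hpos := warpForm_gram_pos B φ hBp huv
  have e : ∀ d, warpForm1 B φ p d u v = warpForm1 B φ p d v u := fun d => by
    simp only [warpForm1, coreForm_comm p.1 u.1, coreForm1_comm p.1 _ u.1]; ring
  have hN := metric_riemannCurvature hS (contDiff_warpMetric hB hφ)
    (fun y v w => by rw [warpMetric_apply, warpMetric_apply, warpForm_comm]) hp
    (fun u hu => by rw [warpMetric_apply]; exact warpForm_self_pos B φ hBp hu)
    (G1 := warpForm1 B φ) (G2 := warpForm2 B φ p)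
    (fun y d v w => by
      simp only [warpMetric_apply]; exact hasDerivAt_warpForm_line hB hφ y d v w)
    (hasDerivAt_warpForm1_line hB hφ p) u v (warpChristoffel B φ p u u)
    (warpChristoffel B φ p u v) (warpChristoffel B φ p v v)
    (fun w => by rw [warpMetric_apply, warpForm_christoffel _ _ _ _ _ _ hBp.ne']; ring)
    (fun w => by rw [warpMetric_apply, warpForm_christoffel _ _ _ _ _ _ hBp.ne'])
    (fun w => by rw [warpMetric_apply, warpForm_christoffel _ _ _ _ _ _ hBp.ne']; ring)
  have hb := warpForm_curvature_bounds hη1 B φ p u v hBp h rfl rfl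
  simp only [warpMetric_apply] at hN
  rw [sectionalCurvature]
  simp only [warpMetric_apply]
  rw [hN, Set.mem_Icc, le_div_iff₀ hpos, div_le_iff₀ hpos]
  constructor <;> linarith [hb.1, hb.2]

end WarpedMetric

/-! ### The two model metrics as warped metrics -/

section Models

theorem ballMetric_eq {H : Type*} [NormedAddCommGroup H] [InnerProductSpace ℂ H] (p u v : H) :
    ballMetric p u v = reForm u v / (1 - ‖p‖ ^ 2)
      + (reForm u p * reForm p v - imForm u p * imForm p v) / (1 - ‖p‖ ^ 2) ^ 2 := by
  have h : (1 - (‖p‖ : ℂ) ^ 2) = ((1 - ‖p‖ ^ 2 : ℝ) : ℂ) := by push_cast; ring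
  rw [ballMetric, h, ← Complex.ofReal_pow]
  simp only [Complex.add_re, Complex.div_ofReal_re, Complex.mul_re, reForm_apply, imForm_apply]

variable {n : ℕ}

theorem toBall_eq (z : Base n) : toBall z = √(weight z) • z := by
  rw [toBall, weight, Real.sqrt_inv]

theorem contDiff_sqrt_weight : ContDiff ℝ ∞ fun z : Base n => √(weight z) :=
  contDiff_weight.sqrt fun z => (weight_pos z).ne'

theorem hasDerivAt_sqrt_weight_line (z d : Base n) :
    HasDerivAt (fun s : ℝ => √(weight (z + s • d))) (-(√(weight z) ^ 3 * reForm z d)) 0 := by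
  have hk := weight_pos z
  have hq := Real.sqrt_pos.2 hk
  have hs := Real.sq_sqrt hk.le
  refine ((hasDerivAt_weight_line z d).sqrt (by simpa using hk.ne')).congr_deriv ?_
  rw [zero_smul, add_zero]
  generalize √(weight z) = q at *
  rw [← hs]
  field_simp

/-- The differential of `toBall`. -/
def toBallDeriv (z u : Base n) : Base n :=
  √(weight z) • u - (√(weight z) ^ 3 * reForm z u) • z

theorem hasDerivAt_toBall_line (z d : Base n) :
    HasDerivAt (fun s : ℝ => toBall (z + s • d)) (toBallDeriv z d) 0 := by
  have h1 : HasDerivAt (fun s : ℝ => z + s • d) d 0 := by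
    simpa using ((hasDerivAt_id (0 : ℝ)).smul_const d).const_add z
  simp only [toBall_eq]
  refine ((hasDerivAt_sqrt_weight_line z d).smul h1).congr_deriv ?_
  simp only [zero_smul, add_zero, toBallDeriv, neg_smul]
  abel

theorem fderiv_toBall (z u : Base n) : fderiv ℝ toBall z u = toBallDeriv z u := by
  have h : ContDiff ℝ ∞ (toBall : Base n → Base n) := by
    have : (toBall : Base n → Base n) = fun z => √(weight z) • z := funext toBall_eq
    rw [this]
    exact contDiff_sqrt_weight.smul contDiff_id
  exact (((h.differentiable (by simp)) z).hasFDerivAt.hasLineDerivAt u).unique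
    (hasDerivAt_toBall_line z u)

theorem norm_toBall_sq (z : Base n) : ‖toBall z‖ ^ 2 = 1 - weight z := by
  rw [toBall_eq, norm_smul, mul_pow, Real.norm_eq_abs, sq_abs, Real.sq_sqrt (weight_pos z).le,
    ← reForm_self]
  linarith [weight_mul z]

theorem coreMetric_eq (z u v : Base n) : coreMetric z u v = coreForm z u v := by
  have hk := weight_pos z
  have hs := Real.sq_sqrt hk.le
  have hm : reForm z z = (weight z)⁻¹ - 1 := by
    have := weight_mul z
    field_simp; linarith
  rw [coreMetric, ballMetric_eq, norm_toBall_sq, fderiv_toBall, fderiv_toBall, toBall_eq]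
  have hq := (Real.sqrt_pos.2 hk).ne'
  simp only [toBallDeriv, map_sub, map_smul, sub_apply, smul_apply, smul_eq_mul, imForm_self, hm,
    coreForm, reForm_comm u z, imForm_comm u z]
  generalize √(weight z) = q at *
  rw [← hs]
  field_simp
  ring

theorem hasDerivAt_tanh (r : ℝ) : HasDerivAt Real.tanh (1 - Real.tanh r ^ 2) r := by
  have h : Real.tanh = fun r => Real.sinh r / Real.cosh r := funext Real.tanh_eq_sinh_div_cosh
  have hc := (Real.cosh_pos r).ne'
  rw [h]
  refine ((Real.hasDerivAt_sinh r).div (Real.hasDerivAt_cosh r) hc).congr_deriv ?_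
  field_simp

theorem contDiff_tanh : ContDiff ℝ ∞ Real.tanh := by
  have h : Real.tanh = fun r => Real.sinh r / Real.cosh r := funext Real.tanh_eq_sinh_div_cosh
  rw [h]
  exact Real.contDiff_sinh.div Real.contDiff_cosh fun r => (Real.cosh_pos r).ne'

theorem polar_eq (x : Cover n) : polar x = WithLp.toLp 2 (toBall x.1,
    ((√(weight x.1) * Real.tanh x.2.2 : ℝ) : ℂ) * Complex.exp (x.2.1 * Complex.I)) := by
  rw [polar, norm_toBall_sq, sub_sub_cancel]

theorem hasDerivAt_polar_line (x d : Cover n) :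
    HasDerivAt (fun s : ℝ => polar (x + s • d)) (WithLp.toLp 2 (toBallDeriv x.1 d.1,
      (((-(√(weight x.1) ^ 3 * reForm x.1 d.1) * Real.tanh x.2.2
          + √(weight x.1) * ((1 - Real.tanh x.2.2 ^ 2) * d.2.2) : ℝ) : ℂ)
        + ((√(weight x.1) * Real.tanh x.2.2 * d.2.1 : ℝ) : ℂ) * Complex.I)
        * Complex.exp (x.2.1 * Complex.I))) 0 := by
  have h1 := hasDerivAt_toBall_line x.1 d.1
  have h2 := ((hasDerivAt_sqrt_weight_line x.1 d.1).mul
    (hasDerivAt_comp_line x.2.2 d.2.2 (hasDerivAt_tanh x.2.2))).ofReal_comp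
  have h3 : HasDerivAt (fun s : ℝ => x.2.1 + s * d.2.1) d.2.1 0 := by
    simpa using ((hasDerivAt_id (0 : ℝ)).mul_const d.2.1).const_add x.2.1
  have h4 := (h3.ofReal_comp.mul_const Complex.I).cexp
  have h5 := h1.prodMk (h2.mul h4)
  have h6 := ((WithLp.prodContinuousLinearEquiv 2 ℝ (Base n) ℂ).symm
    : (Base n × ℂ) →L[ℝ] WithLp 2 (Base n × ℂ)).hasFDerivAt.comp_hasDerivAt (0 : ℝ) h5
  have e : (fun s : ℝ => polar (x + s • d)) = fun s : ℝ => WithLp.toLp 2 (toBall (x.1 + s • d.1),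
      ((√(weight (x.1 + s • d.1)) * Real.tanh (x.2.2 + s * d.2.2) : ℝ) : ℂ)
        * Complex.exp ((x.2.1 + s * d.2.1 : ℝ) * Complex.I)) := by
    ext1 s
    rw [polar_eq]
    rfl
  rw [e]
  refine h6.congr_deriv ?_
  simp only [ContinuousLinearEquiv.coe_coe, WithLp.prodContinuousLinearEquiv_symm_apply]
  congr 2
  simp only [zero_smul, add_zero, zero_mul, Pi.mul_apply]
  push_cast
  ring

theorem differentiable_polar : Differentiable ℝ (polar : Cover n → _) := by
  have e : (polar : Cover n → _) = fun x : Cover n => (WithLp.prodContinuousLinearEquiv 2 ℝ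
      (Base n) ℂ).symm (√(weight x.1) • x.1,
        ((√(weight x.1) * Real.tanh x.2.2 : ℝ) : ℂ) * Complex.exp (x.2.1 * Complex.I)) := by
    ext1 x
    rw [polar_eq, toBall_eq]
    rfl
  have h1 : Differentiable ℝ fun x : Cover n => √(weight x.1) :=
    (contDiff_sqrt_weight.differentiable (by simp)).comp differentiable_fst
  have h2 : Differentiable ℝ fun x : Cover n => Real.tanh x.2.2 :=
    (contDiff_tanh.differentiable (by simp)).comp (differentiable_snd.comp differentiable_snd)
  have h3 : Differentiable ℝ fun x : Cover n => ((√(weight x.1) * Real.tanh x.2.2 : ℝ) : ℂ) :=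
    Complex.ofRealCLM.differentiable.comp (h1.mul h2)
  have h4 : Differentiable ℝ fun x : Cover n => Complex.exp (x.2.1 * Complex.I) := by
    have : Differentiable ℝ fun x : Cover n => ((x.2.1 : ℝ) : ℂ) :=
      Complex.ofRealCLM.differentiable.comp
        (by fun_prop : Differentiable ℝ fun x : Cover n => x.2.1)
    exact (this.mul_const _).cexp
  rw [e]
  exact (ContinuousLinearEquiv.differentiable _).comp
    ((h1.smul differentiable_fst).prodMk (h3.mul h4))

/-- Rotation of the last coordinate is unitary. It removes the common phase `e^(iθ)` from the polar
map and its differential. -/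
theorem reForm_toLp_mul (a c : Base n) (b d e : ℂ) (he : e.re ^ 2 + e.im ^ 2 = 1) :
    reForm (WithLp.toLp 2 (a, b * e)) (WithLp.toLp 2 (c, d * e))
      = reForm a c + (b.re * d.re + b.im * d.im) := by
  simp only [reForm_apply, WithLp.prod_inner_apply, RCLike.inner_apply, Complex.add_re,
    Complex.mul_re, Complex.mul_im, Complex.conj_re, Complex.conj_im]
  linear_combination (b.re * d.re + b.im * d.im) * he

theorem imForm_toLp_mul (a c : Base n) (b d e : ℂ) (he : e.re ^ 2 + e.im ^ 2 = 1) :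
    imForm (WithLp.toLp 2 (a, b * e)) (WithLp.toLp 2 (c, d * e))
      = imForm a c + (b.re * d.im - b.im * d.re) := by
  simp only [imForm_apply, WithLp.prod_inner_apply, RCLike.inner_apply, Complex.add_im,
    Complex.mul_re, Complex.mul_im, Complex.conj_re, Complex.conj_im]
  linear_combination (b.re * d.im - b.im * d.re) * he

theorem complexHyperbolicMetric_eq (x u v : Cover n) :
    complexHyperbolicMetric x u v
      = warpForm (fun r => Real.sinh r * Real.cosh r) (fun _ => 1) x u v := by
  have hf : ∀ d, fderiv ℝ polar x d = _ := fun d =>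
    ((differentiable_polar x).hasFDerivAt.hasLineDerivAt d).unique (hasDerivAt_polar_line x d)
  have hk := weight_pos x.1
  have hs := Real.sq_sqrt hk.le
  have hm : reForm x.1 x.1 = (weight x.1)⁻¹ - 1 := by
    have := weight_mul x.1
    field_simp; linarith
  have he : (Complex.exp (x.2.1 * Complex.I)).re ^ 2 + (Complex.exp (x.2.1 * Complex.I)).im ^ 2
      = 1 := by
    rw [Complex.exp_ofReal_mul_I_re, Complex.exp_ofReal_mul_I_im, Real.cos_sq_add_sin_sq]
  have hC := Real.cosh_pos x.2.2
  have hCS := Real.cosh_sq x.2.2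
  have hT : 1 - Real.tanh x.2.2 ^ 2 = 1 / Real.cosh x.2.2 ^ 2 := by
    rw [Real.tanh_eq_sinh_div_cosh]; field_simp; linarith
  have hT0 : 1 - Real.tanh x.2.2 ^ 2 ≠ 0 := by rw [hT]; positivity
  have hC2 : Real.cosh x.2.2 ^ 2 = 1 / (1 - Real.tanh x.2.2 ^ 2) := by rw [hT]; field_simp
  have hSC : (Real.sinh x.2.2 * Real.cosh x.2.2) ^ 2
      = Real.tanh x.2.2 ^ 2 / (1 - Real.tanh x.2.2 ^ 2) ^ 2 := by
    rw [hT, Real.tanh_eq_sinh_div_cosh]; field_simp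
  have hq := (Real.sqrt_pos.2 hk).ne'
  rw [complexHyperbolicMetric, ballMetric_eq, hf, hf, polar_eq, ← reForm_self, toBall_eq, warpForm,
    hC2, hSC]
  simp only [reForm_toLp_mul _ _ _ _ _ he, imForm_toLp_mul _ _ _ _ _ he, toBallDeriv, map_sub,
    map_smul, sub_apply, smul_apply,
    smul_eq_mul, imForm_self, hm, coreForm, reForm_comm u.1 x.1, imForm_comm u.1 x.1,
    Complex.add_re, Complex.add_im, Complex.mul_re, Complex.mul_im, Complex.ofReal_re,
    Complex.ofReal_im, Complex.I_re, Complex.I_im, angular]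
  generalize Real.tanh x.2.2 = T at *
  generalize √(weight x.1) = q at *
  rw [← hs]
  -- This is `1 - ‖polar x‖² = weight x.1 * (1 - tanh² r)`, the denominator of the ball metric.
  have hD : 1 - (q * (q * ((q ^ 2)⁻¹ - 1)) + (q * T * (q * T) + 0 * 0)) = q ^ 2 * (1 - T ^ 2) := by
    field_simp; ring
  rw [hD]
  field_simp
  ring

theorem integrableMetric_eq (x u v : Cover n) :
    integrableMetric x u v
      = warpForm (fun r => Real.sinh r * Real.cosh r) (fun _ => 0) x u v := by
  rw [integrableMetric, coreMetric_eq, warpForm, Real.sinh_two_mul]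
  simp only [angular]
  ring

end Models

/-! ### The delay `ψ` and the cut-off `Φ` -/

section Profile

theorem contDiff_smoothTransition : ContDiff ℝ ∞ Real.smoothTransition :=
  Real.smoothTransition.contDiff

theorem contDiff_deriv_of_contDiff {f : ℝ → ℝ} (hf : ContDiff ℝ ∞ f) : ContDiff ℝ ∞ (deriv f) :=
  hf.iterate_deriv 1

theorem hasDerivAt_smoothTransition (y : ℝ) :
    HasDerivAt Real.smoothTransition (deriv Real.smoothTransition y) y :=
  ((contDiff_smoothTransition.differentiable (by simp)) y).hasDerivAt

theorem hasDerivAt_deriv_smoothTransition (y : ℝ) :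
    HasDerivAt (deriv Real.smoothTransition) (deriv (deriv Real.smoothTransition) y) y :=
  (((contDiff_deriv_of_contDiff contDiff_smoothTransition).differentiable (by simp)) y).hasDerivAt

theorem deriv_smoothTransition_of_lt_zero {y : ℝ} (hy : y < 0) :
    deriv Real.smoothTransition y = 0 := by
  have h : Real.smoothTransition =ᶠ[nhds y] fun _ => 0 := by
    filter_upwards [Iio_mem_nhds hy] with x hx
    exact Real.smoothTransition.zero_of_nonpos (le_of_lt hx)
  rw [h.deriv_eq, deriv_const]

theorem deriv_smoothTransition_of_one_lt {y : ℝ} (hy : 1 < y) :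
    deriv Real.smoothTransition y = 0 := by
  have h : Real.smoothTransition =ᶠ[nhds y] fun _ => 1 := by
    filter_upwards [Ioi_mem_nhds hy] with x hx
    exact Real.smoothTransition.one_of_one_le (le_of_lt hx)
  rw [h.deriv_eq, deriv_const]

theorem deriv_deriv_smoothTransition_of_lt_zero {y : ℝ} (hy : y < 0) :
    deriv (deriv Real.smoothTransition) y = 0 := by
  have h : deriv Real.smoothTransition =ᶠ[nhds y] fun _ => 0 := by
    filter_upwards [Iio_mem_nhds hy] with x hx
    exact deriv_smoothTransition_of_lt_zero hx
  rw [h.deriv_eq, deriv_const]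

theorem deriv_deriv_smoothTransition_of_one_lt {y : ℝ} (hy : 1 < y) :
    deriv (deriv Real.smoothTransition) y = 0 := by
  have h : deriv Real.smoothTransition =ᶠ[nhds y] fun _ => 0 := by
    filter_upwards [Ioi_mem_nhds hy] with x hx
    exact deriv_smoothTransition_of_one_lt hx
  rw [h.deriv_eq, deriv_const]

theorem exists_bound_deriv_smoothTransition : ∃ M : ℝ, 0 ≤ M ∧
    (∀ y, |deriv Real.smoothTransition y| ≤ M) ∧
    ∀ y, |deriv (deriv Real.smoothTransition) y| ≤ M := by
  have h1 := contDiff_deriv_of_contDiff contDiff_smoothTransition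
  have h2 := contDiff_deriv_of_contDiff h1
  obtain ⟨M1, hM1⟩ := isCompact_Icc.exists_bound_of_continuousOn (s := Icc (0 : ℝ) 1)
    h1.continuous.continuousOn
  obtain ⟨M2, hM2⟩ := isCompact_Icc.exists_bound_of_continuousOn (s := Icc (0 : ℝ) 1)
    h2.continuous.continuousOn
  have hM10 : 0 ≤ M1 := (norm_nonneg _).trans (hM1 0 (by simp))
  have hM20 : 0 ≤ M2 := (norm_nonneg _).trans (hM2 0 (by simp))
  refine ⟨M1 + M2, by positivity, fun y => ?_, fun y => ?_⟩
  · rcases lt_or_ge y 0 with hy | hy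
    · rw [deriv_smoothTransition_of_lt_zero hy, abs_zero]; positivity
    rcases lt_or_ge 1 y with hy1 | hy1
    · rw [deriv_smoothTransition_of_one_lt hy1, abs_zero]; positivity
    have := hM1 y ⟨hy, hy1⟩
    rw [Real.norm_eq_abs] at this
    linarith
  · rcases lt_or_ge y 0 with hy | hy
    · rw [deriv_deriv_smoothTransition_of_lt_zero hy, abs_zero]; positivity
    rcases lt_or_ge 1 y with hy1 | hy1
    · rw [deriv_deriv_smoothTransition_of_one_lt hy1, abs_zero]; positivity
    have := hM2 y ⟨hy, hy1⟩
    rw [Real.norm_eq_abs] at this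
    linarith

/-- A smooth convex function that vanishes on `(-∞, 0]` and has slope `1` on `[1, ∞)`. -/
def smoothRamp (y : ℝ) : ℝ := ∫ x in (0 : ℝ)..y, Real.smoothTransition x

theorem hasDerivAt_smoothRamp (y : ℝ) : HasDerivAt smoothRamp (Real.smoothTransition y) y :=
  intervalIntegral.integral_hasDerivAt_right
    (Real.smoothTransition.continuous.intervalIntegrable _ _)
    (Real.smoothTransition.continuous.stronglyMeasurableAtFilter _ _)
    Real.smoothTransition.continuous.continuousAt

theorem contDiff_smoothRamp : ContDiff ℝ ∞ smoothRamp := by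
  rw [contDiff_infty_iff_deriv]
  refine ⟨fun y => (hasDerivAt_smoothRamp y).differentiableAt, ?_⟩
  rw [show deriv smoothRamp = Real.smoothTransition from
    funext fun y => (hasDerivAt_smoothRamp y).deriv]
  exact contDiff_smoothTransition

theorem smoothRamp_zero : smoothRamp 0 = 0 := by simp [smoothRamp]

theorem smoothRamp_of_nonpos {y : ℝ} (hy : y ≤ 0) : smoothRamp y = 0 := by
  rw [smoothRamp, intervalIntegral.integral_congr (g := fun _ => (0 : ℝ)), intervalIntegral.integral_zero]
  intro x hx
  rw [uIcc_of_ge hy] at hx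
  exact Real.smoothTransition.zero_of_nonpos hx.2

/-- The lag of the ramp behind the identity increases until `y = 1` and is constant afterwards; that
constant is the `c` of `exists_delay_and_cutoff`. -/
theorem monotone_id_sub_smoothRamp : Monotone fun y => y - smoothRamp y := by
  refine monotone_of_deriv_nonneg (differentiable_id.sub
    fun y => (hasDerivAt_smoothRamp y).differentiableAt) fun y => ?_
  have h : HasDerivAt (fun y => y - smoothRamp y) (1 - Real.smoothTransition y) y :=
    (hasDerivAt_id y).sub (hasDerivAt_smoothRamp y)
  rw [h.deriv]
  linarith [Real.smoothTransition.le_one y]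

theorem smoothRamp_le {y : ℝ} (hy : 0 ≤ y) : smoothRamp y ≤ y := by
  have := monotone_id_sub_smoothRamp hy
  simp only [smoothRamp_zero] at this
  linarith

theorem smoothRamp_of_one_le {y : ℝ} (hy : 1 ≤ y) : smoothRamp y = y - (1 - smoothRamp 1) := by
  have h : ∫ x in (1 : ℝ)..y, Real.smoothTransition x = y - 1 := by
    rw [intervalIntegral.integral_congr (g := fun _ => (1 : ℝ)), intervalIntegral.integral_const]
    · simp
    intro x hx
    rw [uIcc_of_le hy] at hx
    exact Real.smoothTransition.one_of_one_le hx.1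
  have h2 := intervalIntegral.integral_add_adjacent_intervals
    (Real.smoothTransition.continuous.intervalIntegrable 0 1 (μ := MeasureTheory.volume))
    (Real.smoothTransition.continuous.intervalIntegrable 1 y)
  rw [h] at h2
  simp only [smoothRamp]
  linarith

theorem le_smoothRamp (y : ℝ) : y - (1 - smoothRamp 1) ≤ smoothRamp y := by
  rcases le_total y 1 with hy | hy
  · have := monotone_id_sub_smoothRamp hy
    simp only at this
    linarith
  · exact (smoothRamp_of_one_le hy).ge

theorem hasDerivAt_comp_affine {f : ℝ → ℝ} {f' : ℝ} (a Λ t : ℝ)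
    (hf : HasDerivAt f f' ((t - a) / Λ)) :
    HasDerivAt (fun s => f ((s - a) / Λ)) (f' / Λ) t := by
  have h : HasDerivAt (fun s : ℝ => (s - a) / Λ) (1 / Λ) t :=
    ((hasDerivAt_id t).sub_const a).div_const Λ
  refine (hf.comp t h).congr_deriv ?_
  ring

set_option maxHeartbeats 1000000 in
/-- A function `ψ` that first grows with slope `1` and then slowly decreases to `0`, and a cut-off
`Φ` that switches on very slowly while `ψ` still has slope `1`. -/
theorem exists_delay_and_cutoff {δ K : ℝ} (hδ : 0 < δ) (hδ1 : δ ≤ 1) (hK : 1 ≤ K) :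
    ∃ ψ Φ : ℝ → ℝ, ∃ T : ℝ, 0 < T ∧ ContDiff ℝ ∞ ψ ∧ ContDiff ℝ ∞ Φ ∧ ψ 0 = 0 ∧ Φ 0 = 0 ∧
      (∀ t, T ≤ t → ψ t = 0 ∧ Φ t = 1) ∧ (∀ t, 0 ≤ Φ t ∧ Φ t ≤ 1) ∧
      ∀ t, 0 ≤ t → 0 ≤ ψ t ∧ -δ ≤ deriv ψ t ∧ deriv ψ t ≤ 1 ∧ |deriv (deriv ψ) t| ≤ δ ∧
        (Φ t = 0 ∨ Real.exp (-ψ t) ≤ δ ∨ |deriv ψ t| ≤ δ) ∧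
        Real.exp (t - ψ t) * |deriv Φ t| ≤ δ / K ∧
        Real.exp (t - ψ t) * |deriv (deriv Φ) t| ≤ δ / K := by
  obtain ⟨M, hM0, hM1, hM2⟩ := exists_bound_deriv_smoothTransition
  have hK0 : 0 < K := by linarith
  -- `Λ` is the length of each transition, long enough for the derivatives of the rescaled steps to
  -- be at most `δ / (3K)`.
  obtain ⟨Λ, hΛdef⟩ : ∃ Λ, Λ = 3 * (M + 1) * K / δ := ⟨_, rfl⟩
  have hΛδ : Λ * δ = 3 * (M + 1) * K := by rw [hΛdef]; field_simp
  have hΛ1 : 1 ≤ Λ := by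
    have h1 : 1 ≤ (M + 1) * K := one_le_mul_of_one_le_of_one_le (by linarith) hK
    rw [hΛdef, le_div_iff₀ hδ]; linarith
  have hΛ0 : 0 < Λ := by linarith
  have hMK : M / Λ ≤ δ / (3 * K) := by
    rw [div_le_div_iff₀ hΛ0 (by positivity)]
    nlinarith
  have hδK : δ / (3 * K) ≤ δ / K := by gcongr; linarith
  have hδK' : 3 * (δ / (3 * K)) ≤ δ := by
    have : 3 * (δ / (3 * K)) = δ / K := by field_simp
    rw [this]; exact div_le_self hδ.le hK
  have hMΛ : M / Λ / Λ ≤ M / Λ := div_le_self (by positivity) hΛ1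
  obtain ⟨c, hc⟩ : ∃ c, c = 1 - smoothRamp 1 := ⟨_, rfl⟩
  have hc0 : 0 ≤ c := by linarith [smoothRamp_le (y := 1) zero_le_one]
  -- `Φ` starts at `t0`, when `e^(-ψ)` is already at most `δ`, and is complete at `T1 = t0 + Λ`,
  -- when `ψ` begins to turn.
  obtain ⟨t0, ht0⟩ : ∃ t0, t0 = 1 / δ := ⟨_, rfl⟩
  have ht0pos : 0 < t0 := by rw [ht0]; positivity
  have hexp0 : Real.exp (-t0) ≤ δ := by
    rw [Real.exp_neg, inv_le_comm₀ (Real.exp_pos _) hδ]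
    have := Real.add_one_le_exp t0
    rw [one_div] at ht0
    linarith
  obtain ⟨T1, hT1⟩ : ∃ T1, T1 = t0 + Λ := ⟨_, rfl⟩
  -- The second turn is timed so that `ψ` ends at exactly `0`: its final value is `(1 + δ)(T1 + cΛ)
  -- - δ(T2 + cΛ)`.
  obtain ⟨T2, hT2⟩ : ∃ T2, T2 = T1 + (T1 + c * Λ) / δ := ⟨_, rfl⟩
  have hT2δ : δ * (T2 + c * Λ) = (1 + δ) * (T1 + c * Λ) := by rw [hT2]; field_simp; ring
  have hT12 : T1 + Λ ≤ T2 := by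
    have h1 : T1 ≤ (T1 + c * Λ) / δ := by
      rw [le_div_iff₀ hδ]
      nlinarith [mul_nonneg hc0 hΛ0.le]
    linarith
  let ψ : ℝ → ℝ := fun t => t - (1 + δ) * Λ * smoothRamp ((t - T1) / Λ)
    + δ * Λ * smoothRamp ((t - T2) / Λ)
  let Φ : ℝ → ℝ := fun t => Real.smoothTransition ((t - t0) / Λ)
  have dψ : ∀ t, HasDerivAt ψ (1 - (1 + δ) * Real.smoothTransition ((t - T1) / Λ)
      + δ * Real.smoothTransition ((t - T2) / Λ)) t := fun t => by
    refine (((hasDerivAt_id t).sub ((hasDerivAt_comp_affine T1 Λ t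
      (hasDerivAt_smoothRamp _)).const_mul ((1 + δ) * Λ))).add ((hasDerivAt_comp_affine T2 Λ t
      (hasDerivAt_smoothRamp _)).const_mul (δ * Λ))).congr_deriv ?_
    field_simp
  have dψ' : deriv ψ = fun t => 1 - (1 + δ) * Real.smoothTransition ((t - T1) / Λ)
      + δ * Real.smoothTransition ((t - T2) / Λ) := funext fun t => (dψ t).deriv
  have ddψ : ∀ t, deriv (deriv ψ) t = -((1 + δ) * (deriv Real.smoothTransition ((t - T1) / Λ) / Λ))
      + δ * (deriv Real.smoothTransition ((t - T2) / Λ) / Λ) := fun t => by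
    rw [dψ']
    exact (((((hasDerivAt_comp_affine T1 Λ t
      (hasDerivAt_smoothTransition _)).const_mul (1 + δ)).const_sub 1).add ((hasDerivAt_comp_affine
      T2 Λ t (hasDerivAt_smoothTransition _)).const_mul δ))).deriv
  have dΦ : deriv Φ = fun t => deriv Real.smoothTransition ((t - t0) / Λ) / Λ :=
    funext fun t => (hasDerivAt_comp_affine t0 Λ t (hasDerivAt_smoothTransition _)).deriv
  have ddΦ : ∀ t, deriv (deriv Φ) t = deriv (deriv Real.smoothTransition) ((t - t0) / Λ) / Λ / Λ :=
    fun t => by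
      rw [dΦ]
      exact ((hasDerivAt_comp_affine t0 Λ t (hasDerivAt_deriv_smoothTransition _)).div_const Λ).deriv
  have ψ_early : ∀ t, t ≤ T1 → ψ t = t := fun t ht => by
    have h1 : (t - T1) / Λ ≤ 0 := div_nonpos_of_nonpos_of_nonneg (by linarith) hΛ0.le
    have h2 : (t - T2) / Λ ≤ 0 := div_nonpos_of_nonpos_of_nonneg (by linarith) hΛ0.le
    simp only [ψ, smoothRamp_of_nonpos h1, smoothRamp_of_nonpos h2]
    ring
  have ψ_middle : ∀ t, T1 ≤ t → t ≤ T1 + Λ → t0 ≤ ψ t := fun t ht ht' => by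
    have h1 : 0 ≤ (t - T1) / Λ := div_nonneg (by linarith) hΛ0.le
    have h2 : (t - T2) / Λ ≤ 0 := div_nonpos_of_nonpos_of_nonneg (by linarith) hΛ0.le
    have h3 := smoothRamp_le h1
    have h4 : Λ * smoothRamp ((t - T1) / Λ) ≤ t - T1 := by
      calc Λ * smoothRamp ((t - T1) / Λ) ≤ Λ * ((t - T1) / Λ) := by gcongr
        _ = t - T1 := by field_simp
    simp only [ψ, smoothRamp_of_nonpos h2]
    nlinarith
  have ramp1 : ∀ t, T1 + Λ ≤ t → Λ * smoothRamp ((t - T1) / Λ) = t - T1 - c * Λ := fun t ht => by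
    rw [smoothRamp_of_one_le (by rw [le_div_iff₀ hΛ0]; linarith), ← hc]; field_simp
  have ψ_late : ∀ t, T1 + Λ ≤ t → 0 ≤ ψ t := fun t ht => by
    have h2 := le_smoothRamp ((t - T2) / Λ)
    have h3 : t - T2 - c * Λ ≤ Λ * smoothRamp ((t - T2) / Λ) := by
      calc t - T2 - c * Λ = Λ * ((t - T2) / Λ - (1 - smoothRamp 1)) := by rw [← hc]; field_simp
        _ ≤ _ := by gcongr
    simp only [ψ, mul_assoc, ramp1 t ht]
    nlinarith
  have ψ_end : ∀ t, T2 + Λ ≤ t → ψ t = 0 := fun t ht => by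
    have h3 : Λ * smoothRamp ((t - T2) / Λ) = t - T2 - c * Λ := by
      rw [smoothRamp_of_one_le (by rw [le_div_iff₀ hΛ0]; linarith), ← hc]; field_simp
    simp only [ψ, mul_assoc, ramp1 t (by linarith), h3]
    linarith
  have hst : ∀ t, Real.smoothTransition ((t - T2) / Λ) ≤ Real.smoothTransition ((t - T1) / Λ) :=
    fun t => Real.smoothTransition.monotone (by gcongr; linarith)
  -- Up to `T1` the factor `e^(t - ψ)` is `1`; beyond `T1` the derivatives of `Φ` vanish.
  have hexpΦ : ∀ t x : ℝ, |x| ≤ M / Λ → (T1 < t → x = 0) →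
      Real.exp (t - ψ t) * |x| ≤ δ / K := fun t x hx hx0 => by
    rcases le_or_gt t T1 with ht | ht
    · rw [ψ_early t ht, sub_self, Real.exp_zero, one_mul]
      linarith
    · rw [hx0 ht, abs_zero, mul_zero]; positivity
  have harg : ∀ t, T1 < t → 1 < (t - t0) / Λ := fun t ht => by
    rw [lt_div_iff₀ hΛ0]; linarith
  have habs : ∀ y, |deriv Real.smoothTransition y / Λ| ≤ M / Λ := fun y => by
    rw [abs_div, abs_of_pos hΛ0]
    gcongr
    exact hM1 _
  refine ⟨ψ, Φ, T2 + Λ, by linarith, ?_, ?_, ψ_early 0 (by linarith), ?_, ?_, ?_, ?_⟩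
  · have h : ∀ a, ContDiff ℝ ∞ fun t : ℝ => smoothRamp ((t - a) / Λ) := fun a =>
      contDiff_smoothRamp.comp ((contDiff_id.sub contDiff_const).div_const Λ)
    exact (contDiff_id.sub (contDiff_const.mul (h T1))).add (contDiff_const.mul (h T2))
  · exact contDiff_smoothTransition.comp ((contDiff_id.sub contDiff_const).div_const Λ)
  · exact Real.smoothTransition.zero_of_nonpos
      (div_nonpos_of_nonpos_of_nonneg (by linarith) hΛ0.le)
  · exact fun t ht => ⟨ψ_end t ht, Real.smoothTransition.one_of_one_le
      (harg t (by linarith)).le⟩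
  · exact fun t => ⟨Real.smoothTransition.nonneg _, Real.smoothTransition.le_one _⟩
  intro t ht
  refine ⟨?_, ?_, ?_, ?_, ?_, ?_, ?_⟩
  · rcases le_total t T1 with h | h
    · rwa [ψ_early t h]
    rcases le_total t (T1 + Λ) with h' | h'
    · exact ht0pos.le.trans (ψ_middle t h h')
    · exact ψ_late t h'
  · rw [dψ']
    have h1 := Real.smoothTransition.le_one ((t - T1) / Λ)
    have h2 := Real.smoothTransition.nonneg ((t - T2) / Λ)
    nlinarith
  · rw [dψ']
    have h1 := Real.smoothTransition.nonneg ((t - T1) / Λ)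
    have h2 := hst t
    nlinarith
  · rw [ddψ]
    have h1 := abs_le.1 (habs ((t - T1) / Λ))
    have h2 := abs_le.1 (habs ((t - T2) / Λ))
    have h3 : 0 ≤ M / Λ := by positivity
    rw [abs_le]
    constructor <;> nlinarith [h1.1, h1.2, h2.1, h2.2]
  · rcases le_total t t0 with h | h
    · exact Or.inl (Real.smoothTransition.zero_of_nonpos
        (div_nonpos_of_nonpos_of_nonneg (by linarith) hΛ0.le))
    rcases le_total t (T1 + Λ) with h' | h'
    · refine Or.inr (Or.inl ((Real.exp_le_exp.2 (neg_le_neg ?_)).trans hexp0))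
      rcases le_total t T1 with h'' | h''
      · rwa [ψ_early t h'']
      · exact ψ_middle t h'' h'
    · refine Or.inr (Or.inr ?_)
      rw [dψ']
      have h1 : Real.smoothTransition ((t - T1) / Λ) = 1 :=
        Real.smoothTransition.one_of_one_le (by rw [le_div_iff₀ hΛ0]; linarith)
      have h2 := Real.smoothTransition.nonneg ((t - T2) / Λ)
      have h3 := Real.smoothTransition.le_one ((t - T2) / Λ)
      simp only [h1]
      rw [abs_le]
      constructor <;> nlinarith
  · simp only [dΦ]
    exact hexpΦ t _ (habs _) fun h => by
      rw [deriv_smoothTransition_of_one_lt (harg t h), zero_div]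
  · rw [ddΦ]
    refine hexpΦ t _ ?_ fun h => by
      rw [deriv_deriv_smoothTransition_of_one_lt (harg t h), zero_div, zero_div]
    rw [abs_div, abs_div, abs_of_pos hΛ0]
    refine le_trans ?_ hMΛ
    gcongr
    exact hM2 _

end Profile

/-! ### The profile functions `B` and `φ` -/

section WarpingProfile

theorem sinh_cosh_bounds_of_le {η r : ℝ} (hη : 0 < η) (hη1 : η ≤ 1) (hr : 10 / η ≤ r) :
    0 < Real.sinh r ∧ Real.sinh r < Real.cosh r ∧ Real.cosh r ≤ Real.sinh r + 1 ∧
      1 / Real.sinh r ≤ η / 10 ∧ 1 ≤ Real.sinh r := by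
  have h0 : 0 < 10 / η := by positivity
  have h10 : 10 ≤ 10 / η := by rw [le_div_iff₀ hη]; linarith
  have hr0 : 0 < r := by linarith
  have hs := Real.self_le_sinh_iff.2 hr0.le
  have hs0 : 0 < Real.sinh r := by linarith
  have he := Real.cosh_sub_sinh r
  have he1 : Real.exp (-r) ≤ 1 := Real.exp_le_one_iff.2 (by linarith)
  refine ⟨hs0, Real.sinh_lt_cosh r, by linarith, ?_, by linarith⟩
  rw [div_le_div_iff₀ hs0 (by norm_num)]
  have := mul_le_mul_of_nonneg_left (hr.trans hs) hη.le
  rw [mul_div_cancel₀ _ hη.ne'] at this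
  linarith

/-- A profile for which `warpForm` interpolates between the two complex hyperbolic metrics. -/
theorem exists_warping_profile {η : ℝ} (hη : 0 < η) (hη1 : η ≤ 1) :
    ∃ r₃ r₄ : ℝ, 0 < r₃ ∧ r₃ < r₄ ∧ ∃ B φ : ℝ → ℝ, ContDiff ℝ ∞ B ∧ ContDiff ℝ ∞ φ ∧
      B r₃ = Real.sinh r₃ * Real.cosh r₃ ∧ φ r₃ = 0 ∧
      (∀ r, r₄ < r → B r = Real.sinh r * Real.cosh r ∧ φ r = 1) ∧
      ∀ r, r₃ ≤ r → 0 < B r ∧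
        ProfileBounds η (B r * φ r / Real.cosh r ^ 2) (B r * deriv φ r / Real.cosh r)
          (B r * deriv (deriv φ) r / Real.cosh r) (deriv B r / B r) (deriv (deriv B) r / B r)
          (Real.sinh r / Real.cosh r) (1 / Real.cosh r) := by
  -- `R` becomes `r₃`, so large that `coth`, `tanh` and `1/cosh` are within `η/10` of their limits.
  -- Since `B/cosh = sinh r e^(-ψ) ≤ e^R e^(t-ψ)` with `t = r - R`, the cut-off is taken with `K =
  -- e^R`.
  obtain ⟨R, hR⟩ : ∃ R, R = 10 / η := ⟨_, rfl⟩
  have hR0 : 0 < R := by rw [hR]; positivity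
  obtain ⟨ψ, Φ, T, hT, hψ, hΦ, hψ0, hΦ0, hend, hΦ01, hall⟩ :=
    exists_delay_and_cutoff (δ := η / 10) (K := Real.exp R) (by positivity) (by linarith)
      (Real.one_le_exp hR0.le)
  have hψ' := contDiff_deriv_of_contDiff hψ
  have hΦ' := contDiff_deriv_of_contDiff hΦ
  let B : ℝ → ℝ := fun r => Real.sinh r * Real.cosh r * Real.exp (-ψ (r - R))
  let φ : ℝ → ℝ := fun r => Φ (r - R)
  have dshift : ∀ {f : ℝ → ℝ}, ContDiff ℝ ∞ f → ∀ r,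
      HasDerivAt (fun r => f (r - R)) (deriv f (r - R)) r := fun {f} hf r =>
    ((hf.differentiable (by simp)) (r - R)).hasDerivAt.comp_sub_const r R
  have dB : ∀ r, HasDerivAt B ((Real.cosh r ^ 2 + Real.sinh r ^ 2
      - Real.sinh r * Real.cosh r * deriv ψ (r - R)) * Real.exp (-ψ (r - R))) r := fun r => by
    refine (((Real.hasDerivAt_sinh r).mul (Real.hasDerivAt_cosh r)).mul
      (dshift hψ r).neg.exp).congr_deriv ?_
    simp only [Pi.mul_apply, Pi.neg_apply]
    ring
  have ddB : ∀ r, HasDerivAt (deriv B) ((4 * Real.sinh r * Real.cosh r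
      - 2 * (Real.cosh r ^ 2 + Real.sinh r ^ 2) * deriv ψ (r - R)
      + Real.sinh r * Real.cosh r * (deriv ψ (r - R) ^ 2 - deriv (deriv ψ) (r - R)))
      * Real.exp (-ψ (r - R))) r := fun r => by
    rw [show deriv B = _ from funext fun r => (dB r).deriv]
    refine (((((Real.hasDerivAt_cosh r).pow 2).add ((Real.hasDerivAt_sinh r).pow 2)).sub
      (((Real.hasDerivAt_sinh r).mul (Real.hasDerivAt_cosh r)).mul (dshift hψ' r))).mul
      (dshift hψ r).neg.exp).congr_deriv ?_
    simp only [Pi.mul_apply, Pi.neg_apply, Pi.add_apply, Pi.sub_apply, Pi.pow_apply,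
      Nat.cast_ofNat]
    ring
  have dφ : deriv φ = fun r => deriv Φ (r - R) := funext fun r => (dshift hΦ r).deriv
  have ddφ : ∀ r, deriv (deriv φ) r = deriv (deriv Φ) (r - R) := fun r => by
    rw [dφ]; exact (dshift hΦ' r).deriv
  refine ⟨R, R + T, hR0, by linarith, B, φ, ?_, ?_, ?_, ?_, ?_, ?_⟩
  · exact (Real.contDiff_sinh.mul Real.contDiff_cosh).mul
      (Real.contDiff_exp.comp (hψ.comp (contDiff_id.sub contDiff_const)).neg)
  · exact hΦ.comp (contDiff_id.sub contDiff_const)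
  · simp [B, hψ0]
  · simp [φ, hΦ0]
  · intro r hr
    obtain ⟨h1, h2⟩ := hend (r - R) (by linarith)
    simp [B, φ, h1, h2]
  intro r hr
  obtain ⟨hs0, hsc, hcs, hs1, hs2⟩ := sinh_cosh_bounds_of_le hη hη1 (hR ▸ hr)
  obtain ⟨hψn, hψl, hψu, hψ2, hcase, hΦ1, hΦ2⟩ := hall (r - R) (by linarith)
  obtain ⟨hΦn, hΦl⟩ := hΦ01 (r - R)
  have hc0 := Real.cosh_pos r
  have hsq := Real.cosh_sq r
  have hE0 := Real.exp_pos (-ψ (r - R))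
  have hE1 : Real.exp (-ψ (r - R)) ≤ 1 := Real.exp_le_one_iff.2 (by linarith)
  have hBpos : 0 < B r := by simp only [B]; positivity
  have hsinh : Real.sinh r ≤ Real.exp R * Real.exp (r - R) := by
    rw [← Real.exp_add, add_sub_cancel]
    linarith [Real.cosh_add_sinh r]
  have hsmall : ∀ x, Real.exp (r - R - ψ (r - R)) * |x| ≤ η / 10 / Real.exp R →
      |B r * x / Real.cosh r| ≤ η := fun x hx => by
    have h1 : B r * x / Real.cosh r = Real.sinh r * Real.exp (-ψ (r - R)) * x := by
      simp only [B]; field_simp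
    rw [h1, abs_mul, abs_of_pos (by positivity)]
    rw [le_div_iff₀ (Real.exp_pos R)] at hx
    calc Real.sinh r * Real.exp (-ψ (r - R)) * |x|
        ≤ Real.exp R * Real.exp (r - R) * Real.exp (-ψ (r - R)) * |x| := by gcongr
      _ = Real.exp (r - R - ψ (r - R)) * |x| * Real.exp R := by
        rw [sub_eq_add_neg (r - R) (ψ (r - R)), Real.exp_add]; ring
      _ ≤ η := by linarith
  have hl : deriv B r / B r = Real.cosh r / Real.sinh r + Real.sinh r / Real.cosh r
      - deriv ψ (r - R) := by
    rw [(dB r).deriv]; simp only [B]; field_simp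
  -- `k - l²` is `(log B)''`, and `(log (sinh r cosh r))'' = -1/(sinh r cosh r)²`.
  have hk : deriv (deriv B) r / B r - (deriv B r / B r) ^ 2
      = -(1 / (Real.sinh r * Real.cosh r) ^ 2) - deriv (deriv ψ) (r - R) := by
    rw [(ddB r).deriv, (dB r).deriv]
    simp only [B]
    field_simp
    rw [hsq]
    linear_combination (4 * Real.sinh r ^ 2 - Real.sinh r ^ 2 * deriv (deriv ψ) (r - R)) * hsq
  have hσ : B r * φ r / Real.cosh r ^ 2
      = Real.sinh r / Real.cosh r * (Real.exp (-ψ (r - R)) * Φ (r - R)) := by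
    simp only [B, φ]; field_simp
  have hL1 : Real.sinh r / Real.cosh r ≤ 1 := by rw [div_le_one hc0]; exact hsc.le
  have hL0 : 0 ≤ Real.sinh r / Real.cosh r := by positivity
  have hEΦ : 0 ≤ Real.exp (-ψ (r - R)) * Φ (r - R) := by positivity
  have hEΦ1 : Real.exp (-ψ (r - R)) * Φ (r - R) ≤ 1 := mul_le_one₀ hE1 hΦn hΦl
  have hic : 1 / Real.cosh r ≤ 1 / Real.sinh r := one_div_le_one_div_of_le hs0 hsc.le
  have hcoth1 : 1 ≤ Real.cosh r / Real.sinh r := by rw [le_div_iff₀ hs0]; linarith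
  have hcoth2 : Real.cosh r / Real.sinh r ≤ 1 + 1 / Real.sinh r := by
    rw [← div_self hs0.ne', ← add_div, div_self hs0.ne']; gcongr
  have htanh : 1 - 1 / Real.cosh r ≤ Real.sinh r / Real.cosh r := by
    rw [← div_self hc0.ne', ← sub_div, div_self hc0.ne']; gcongr; linarith
  have hsc2 : 1 / (Real.sinh r * Real.cosh r) ^ 2 ≤ 1 / Real.sinh r := by
    refine one_div_le_one_div_of_le hs0 ?_
    have h1 : 1 ≤ Real.cosh r := Real.one_le_cosh r
    have h2 : Real.sinh r ≤ Real.sinh r * Real.cosh r := le_mul_of_one_le_right hs0.le h1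
    nlinarith
  have hsc20 : 0 ≤ 1 / (Real.sinh r * Real.cosh r) ^ 2 := by positivity
  have hic0 : 0 ≤ 1 / Real.cosh r := by positivity
  rw [abs_le] at hψ2
  refine ⟨hBpos, ?_, ?_, ?_, ?_, ?_, ?_, ?_, ?_, hL1, hic0, ?_, ?_⟩
  · rw [hσ]; positivity
  · rw [hσ]; exact mul_le_one₀ hL1 hEΦ hEΦ1
  · rw [dφ]; exact hsmall _ hΦ1
  · rw [ddφ]; exact hsmall _ hΦ2
  · rw [hl]; linarith
  · rw [hl]; linarith
  · rw [hk, abs_le]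
    constructor <;> linarith [hψ2.1, hψ2.2]
  · linarith
  · nlinarith
  · rcases hcase with h | h | h
    · left; rw [hσ, h, mul_zero, mul_zero]; exact hη.le
    · left
      rw [hσ]
      have h1 : Real.exp (-ψ (r - R)) * Φ (r - R) ≤ η / 10 :=
        (mul_le_of_le_one_right hE0.le hΦl).trans h
      have h2 := mul_le_of_le_one_left hEΦ hL1
      linarith
    · right
      rw [abs_le] at h
      rw [hl, abs_le]
      constructor <;> linarith [h.1, h.2]

end WarpingProfile

/-! ### Descent to `E × ℝ` and the conclusion -/

section Interpolation

theorem uniqueDiffOn_halfSpace (n : ℕ) (a : ℝ) : UniqueDiffOn ℝ (halfSpace n a) := by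
  refine uniqueDiffOn_convex ?_ ?_
  · have h : IsLinearMap ℝ fun x : Cover n => x.2.2 := ⟨fun _ _ => rfl, fun _ _ => rfl⟩
    exact convex_halfSpace_ge h a
  · have hopen : IsOpen {x : Cover n | a < x.2.2} :=
      isOpen_lt continuous_const (continuous_snd.comp continuous_snd)
    have hsub : {x : Cover n | a < x.2.2} ⊆ halfSpace n a :=
      fun x (hx : a < x.2.2) => (le_of_lt hx : a ≤ x.2.2)
    exact ⟨(0, 0, a + 1), interior_maximal hsub hopen (lt_add_one a)⟩

/-- The metric `warpMetric B φ` on `E × ℝ`; its coefficients do not depend on `θ`. -/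
def warpField (n : ℕ) (B φ : ℝ → ℝ) : FormField n := fun q => warpMetric B φ (q.1.1, 0, q.2)

theorem lift_warpField (n : ℕ) (B φ : ℝ → ℝ) : (warpField n B φ).lift = warpMetric B φ := by
  refine funext fun x => ContinuousLinearMap.ext fun u => ContinuousLinearMap.ext fun v => ?_
  simp only [FormField.lift, warpField, toE, warpMetric_apply, warpForm, angular]

end Interpolation

end Warping

end

theorem corollary3p3 (n : ℕ) (hn : 2 ≤ n) (ε : ℝ) (hε : 0 < ε) :
    ∃ r₃ r₄ : ℝ, 0 < r₃ ∧ r₃ < r₄ ∧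
      ∃ g : Warping.FormField n, Warping.IsRiemannianMetric r₃ g ∧
        (∀ x : Warping.Cover n, x.2.2 = r₃ →
          ∀ u v, g.lift x u v = Warping.integrableMetric x u v) ∧
        (∀ x : Warping.Cover n, r₄ < x.2.2 →
          ∀ u v, g.lift x u v = Warping.complexHyperbolicMetric x u v) ∧
        ∀ x ∈ Warping.halfSpace n r₃, ∀ u v : Warping.Cover n, LinearIndependent ℝ ![u, v] →
          Warping.sectionalCurvature (Warping.halfSpace n r₃) g.lift x u v
            ∈ Set.Ioo (-4 - ε) (-1 + ε) := by
  -- The strict inequality puts the closed interval with margin `30 η` inside the open one with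
  -- margin `ε`.
  obtain ⟨η, hη, hη1, hηε⟩ : ∃ η : ℝ, 0 < η ∧ η ≤ 1 ∧ 30 * η < ε :=
    ⟨min 1 (ε / 31), by positivity, min_le_left _ _, by
      have := min_le_right 1 (ε / 31); linarith⟩
  obtain ⟨r₃, r₄, h0, h34, B, φ, hB, hφ, hB3, hφ3, h4, hall⟩ :=
    Warping.exists_warping_profile hη hη1
  refine ⟨r₃, r₄, h0, h34, Warping.warpField n B φ, ⟨?_, ?_, ?_⟩, ?_, ?_, ?_⟩
  · intro q _ u v
    simp only [Warping.warpField, Warping.warpMetric_apply]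
    exact Warping.warpForm_comm _ _ _ _ _
  · intro q hq u hu
    simp only [Warping.warpField, Warping.warpMetric_apply]
    exact Warping.warpForm_self_pos B φ (hall q.2 hq).1 hu
  · rw [Warping.lift_warpField]
    exact (Warping.contDiff_warpMetric hB hφ).contDiffOn
  · intro x hx u v
    rw [Warping.lift_warpField, Warping.warpMetric_apply, Warping.integrableMetric_eq]
    simp only [Warping.warpForm, Warping.angular, hx, hB3, hφ3]
  · intro x hx u v
    rw [Warping.lift_warpField, Warping.warpMetric_apply, Warping.complexHyperbolicMetric_eq]
    simp only [Warping.warpForm, Warping.angular, (h4 _ hx).1, (h4 _ hx).2]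
  · intro x hx u v huv
    rw [Warping.lift_warpField]
    have h := Warping.sectionalCurvature_warpMetric (Warping.uniqueDiffOn_halfSpace n r₃) hB hφ hx
      (hall _ hx).1 hη1 (hall _ hx).2 huv
    exact ⟨by linarith [h.1], by linarith [h.2]⟩
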